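/- **Setting.** Let $\mathcal X$ be a non-empty standard Borel space (for instance a Borel subset of $\mathbb R^r$), $\mathcal A=[0,1]^d$, $\mathcal Y=\mathbb R$, and let $\mu$ be a probability measure on $\mathcal A$. For a distribution $Q$ of $(X,A,Y)$ put $m_Q(x,a)=E_Q[Y\mid X=x,A=a]$ and $\theta_Q(a)=\int m_Q(x,a)\,Q_X(dx)$. *Kernel.* Let $\mathcal H$ be a reproducing kernel Hilbert space of functions on $\mathcal A$ with a continuous, strictly positive definite kernel $\mathcal K$. Let $\sigma_1\ge\sigma_2\ge\cdots$ and $e_1,e_2,\ldots$ be the eigenvalues and a corresponding $L^2(\mu)$-orthonormal system of eigenfunctions of $T_{\mathcal K}\theta=\int\mathcal K(\cdot,t)\theta(t)\,\mu(dt)$, so that $T_{\mathcal K}=\sum_j\sigma_j\langle\cdot,e_j\rangle_{L^2(\mu)} e_j$, and put $T_{\mathcal K}^{s}=\sum_j\sigma_j^{s}\langle\cdot,e_j\rangle_{L^2(\mu)} e_j$. Assume that $|e_j|\le M_e$ $\mu$-a.e. for all $j$, with a constant $M_e<\infty$, and that $G_1j^{-1/p}\le\sigma_j\le G_2j^{-1/p}$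 for all $j\ge1$, with constants $p\in(0,1)$ and $G_1,G_2>0$. *Target model.* Fix $\alpha\in(0,1/2)$ with $1-2\alpha\ge p$, and $R,\sigma,L>0$, $c_\mu\ge1$. Let $\mathcal Q$ be the set of all distributions $Q$ of $(X,A,Y)$ such that: (i) $|m_Q(x,a)|\le1$ for $Q_X\times\mu$-a.e. $(x,a)$; (ii) $\int|y-\theta_Q(a)|^m\,Q(dy\mid x,a)\le\frac12m!\,\sigma^2L^{m-2}$ for all integers $m\ge2$ and $Q_{X,A}$-a.e. $(x,a)$; (iii) for $Q_X$-a.e. $x$, $\mu\ll Q_{A\mid X}(\cdot\mid x)$ and $c_\mu^{-1}\le \frac{d\mu}{dQ_{A\mid X}(\cdot\mid x)}\le c_\mu$ $Q_{A\mid X}(\cdot\mid x)$-a.e.; (iv) $\|T_{\mathcal K}^{\alpha}\theta_Q\|_{\mathcal H}\le R$. *Observation model.* Given $k$ sources, $\mathcal S_X,\mathcal S_Y\subseteq[k]$ and $M_\xi,M_\eta,c_1\ge1$, let $\mathcal P$ be the set of all distributions $P$ of $(X,A,Y,S)$ on $\mathcal X\times\mathcal A\times\mathcal Y\times[k]$ such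 that for some $Q\in\mathcal Q$: $P(S\in\mathcal S_X)\ge M_\xi^{-1}$ and $P(S\in\mathcal S_Y)\ge M_\eta^{-1}$; $Q_{X,A}\ll P_{X,A}(\cdot\mid S=s)$ for all $s\in\mathcal S_Y$, and $c_1^{-1}\le\frac{dQ_{X,A}}{dP_{X,A}(\cdot\mid S\in\mathcal S_Y)}\le c_1$ $Q_{X,A}$-a.e.; $P_X(\cdot\mid S=s)=Q_X$ for all $s\in\mathcal S_X$; and $P_{Y\mid X,A}(\cdot\mid x,a,s)=Q_{Y\mid X,A}(\cdot\mid x,a)$ for all $s\in\mathcal S_Y$ and $Q_{X,A}$-a.e. $(x,a)$. (Conditions given $S=s$ are imposed when $P(S=s)>0$.) *Risk.* For $P\in\mathcal P$ let $g_0=(\xi_0,\eta_0,w_0,m_0,\theta_0)$ with $\xi_0=1/P(S\in\mathcal S_X)$, $\eta_0=1/P(S\in\mathcal S_Y)$, $w_0(x,a)=\frac{p(x\mid S\in\mathcal S_X)}{p(x\mid S\in\mathcal S_Y)}\cdot\frac1{p(a\mid x,S\in\mathcal S_Y)}$ (the last density being with respect to $\mu$), $m_0(x,a)=E_P[Y\mid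 X=x,A=a,S\in\mathcal S_Y]$ and $\theta_0(a)=E_P[m_0(X,a)\mid S\in\mathcal S_X]$. The risk $L_P(\theta,g_0)$ of $\theta\in L^2(\mu)$ is the expectation, under $((X,A,Y,S),B)\sim P\times\mu$, of $$(\theta(B)-\theta_0(B))^2+2\xi_0\mathbf 1(S\in\mathcal S_X)(\theta(B)-\theta_0(B))(\theta_0(B)-m_0(X,B))+2\eta_0w_0(X,A)\mathbf 1(S\in\mathcal S_Y)(\theta(A)-\theta_0(A))(m_0(X,A)-Y).$$ *Estimators.* An estimator $\underline\theta$ that does not use data fusion maps a sample $\{(X_i,A_i,Y_i,S_i)\}_{i=1}^n$ to an element of $L^2(\mu)$ and is measurable with respect to the $\sigma$-algebra generated by $\{(X_i,A_i,Y_i)\}_{i:S_i\in\mathcal S_X\cap\mathcal S_Y}$. **Claim.** Let $\rho=\frac{1-2\alpha}{p+(1-2\alpha)}$ and, for $\delta\in(0,1)$, $$N_\delta=\tfrac14\Bigl(\sqrt{3\log\tfrac2\delta+4(\tfrac\delta{32})^{-1-(1-2\alpha)/p}}-\sqrt{3\log\tfrac2\delta}\Bigr)^2 .$$ There is a constant $c_{\mathcal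 Q}>0$, depending only on the target model (that is, on $\mathcal X,\mu,\mathcal H,(\sigma_j,e_j)_j$ and the constants $M_e,p,G_1,G_2,\alpha,R,\sigma,L,c_\mu$), such that the following holds for all $k,\mathcal S_X,\mathcal S_Y,M_\xi,M_\eta,c_1$ as above, every $\delta\in(0,1)$, every integer $n$ and real $n_{XY}$ with $n\ge n_{XY}\ge N_\delta$, and every estimator $\underline\theta$ based on $n$ observations that does not use data fusion. For every probability vector $q$ on $[k]$ with $q(\mathcal S_X\cap\mathcal S_Y)=n_{XY}/n$, $q(\mathcal S_X)\ge M_\xi^{-1}$ and $q(\mathcal S_Y)\ge M_\eta^{-1}$, there is $P\in\mathcal P$ with $P(S=s)=q_s$ for all $s$, so that $P(S\in\mathcal S_X\cap\mathcal S_Y)=n_{XY}/n$, such that with probability at least $1-2\delta$ under $P^n$, $$L_P(\underline\theta,g_0)\ \ge\ c_{\mathcal Q}\,\delta\,\Bigl(1+\sqrt{3\log(1/\delta)/n_{XY}}\Bigr)^{-\rho}\,n_{XY}^{-\rho}.$$ -/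

import Mathlib

open MeasureTheory ProbabilityTheory
open scoped ENNReal

noncomputable section

namespace DataFusion

/-! ### Sample spaces and laws -/

/-- The exposure space, the cube `[0, 1] ^ d`. -/
abbrev Dose (d : ℕ) : Type := Fin d → unitInterval

/-- The space of triples `(x, a, y)`: covariates, exposure, real outcome. -/
abbrev Unit3 (X : Type*) (d : ℕ) : Type _ := X × Dose d × ℝ

/-- The space of observations `(x, a, y, s)`, where `s` is one of `k` data sources. -/
abbrev Obs (X : Type*) (d k : ℕ) : Type _ := X × Dose d × ℝ × Fin k

section Laws

variable {X : Type*} [MeasurableSpace X] {d k : ℕ}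

/-- The marginal law of `X`. -/
def xLaw (Q : Measure (Unit3 X d)) : Measure X := Q.map fun z => z.1

/-- The marginal law of `(X, A)`. -/
def xaLaw (Q : Measure (Unit3 X d)) : Measure (X × Dose d) := Q.map fun z => (z.1, z.2.1)

/-- The conditional law of `A` given `X`. -/
def aGivenX (Q : Measure (Unit3 X d)) [IsFiniteMeasure Q] : Kernel X (Dose d) :=
  condDistrib (fun z => z.2.1) (fun z => z.1) Q

/-- The conditional law of `Y` given `(X, A)`. -/
def yGivenXA (Q : Measure (Unit3 X d)) [IsFiniteMeasure Q] : Kernel (X × Dose d) ℝ :=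
  condDistrib (fun z => z.2.2) (fun z => (z.1, z.2.1)) Q

/-- The outcome regression `m_Q(x, a) = E_Q[Y | X = x, A = a]`. -/
def outcomeMean (Q : Measure (Unit3 X d)) [IsFiniteMeasure Q] (x : X) (a : Dose d) : ℝ :=
  ∫ y, y ∂(yGivenXA Q (x, a))

/-- The causal dose response function `θ_Q(a) = ∫ E_Q[Y | X = x, A = a] Q_X(dx)`. -/
def cdrf (Q : Measure (Unit3 X d)) [IsFiniteMeasure Q] (a : Dose d) : ℝ :=
  ∫ x, outcomeMean Q x a ∂(xLaw Q)

/-- The event `S ∈ T`. -/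
def sourceIn (X : Type*) (d : ℕ) {k : ℕ} (T : Finset (Fin k)) : Set (Obs X d k) :=
  {z | z.2.2.2 ∈ T}

/-- The conditional law of `(X, A, Y)` given `S ∈ T`, under `P`. It is a probability measure when
`P(S ∈ T) > 0`. -/
def lawGiven (P : Measure (Obs X d k)) (T : Finset (Fin k)) : Measure (Unit3 X d) :=
  (P[|sourceIn X d T]).map fun z => (z.1, z.2.1, z.2.2.1)

instance (P : Measure (Obs X d k)) (T : Finset (Fin k)) : IsFiniteMeasure (lawGiven P T) := by
  unfold lawGiven
  infer_instance

end Laws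

/-! ### The reproducing kernel Hilbert space -/

section Kernels

variable {d : ℕ} (H : Type*) [NormedAddCommGroup H] [InnerProductSpace ℝ H] [CompleteSpace H]
  [RKHS ℝ H (Dose d) ℝ]

/-- The real-valued reproducing kernel of `H`. -/
def reprKernel (a t : Dose d) : ℝ := RKHS.kernel H a t 1

/-- The reproducing kernel is continuous and strictly positive definite: Gram matrices at distinct
points are positive definite. -/
structure KernelCondition : Prop where
  continuous : Continuous fun q : Dose d × Dose d => reprKernel H q.1 q.2
  strictPosDef : ∀ (N : ℕ) (t : Fin N → Dose d), Function.Injective t →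
    (Matrix.of fun i j => reprKernel H (t i) (t j)).PosDef

/-- `(ev j, ef j)`, `j = 0, 1, 2, …`, is the spectral decomposition of the kernel integral
operator `T θ = ∫ K(·, t) θ(t) μ(dt)` on `L²(μ)`: the eigenvalues are non-increasing, the
eigenfunctions are orthonormal in `L²(μ)`, and `T f = ∑ j, ev j * ⟪ef j, f⟫ * ef j`. The pair
number `j` here is the pair number `j + 1` in the usual enumeration from one. -/
structure IsSpectralDecomposition (μ : Measure (Dose d)) (ev : ℕ → ℝ) (ef : ℕ → Lp ℝ 2 μ) :
    Prop where
  antitone : Antitone ev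
  orthonormal : Orthonormal ℝ ef
  decomposition : ∀ f : Lp ℝ 2 μ, ∃ g : Lp ℝ 2 μ,
    (⇑g =ᵐ[μ] fun a => ∫ t, reprKernel H a t * f t ∂μ) ∧
    HasSum (fun j => (ev j * inner ℝ (ef j) f) • ef j) g

/-- The fractional power `T ^ s` of the kernel integral operator, through its spectral
decomposition. -/
def powerOp {μ : Measure (Dose d)} (ev : ℕ → ℝ) (ef : ℕ → Lp ℝ 2 μ) (s : ℝ) (f : Lp ℝ 2 μ) :
    Lp ℝ 2 μ :=
  ∑' j, (ev j ^ s * inner ℝ (ef j) f) • ef j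

/-- `‖T ^ α θ‖_H ≤ R`: the `L²(μ)`-class of `T ^ α θ` is the class of an element of `H` whose
`H`-norm is at most `R`. -/
def SourceCondition {μ : Measure (Dose d)} (ev : ℕ → ℝ) (ef : ℕ → Lp ℝ 2 μ) (α R : ℝ)
    (θ : Dose d → ℝ) : Prop :=
  ∃ f : Lp ℝ 2 μ, ⇑f =ᵐ[μ] θ ∧ ∃ h : H, ⇑h =ᵐ[μ] ⇑(powerOp ev ef α f) ∧ ‖h‖ ≤ R

end Kernels

/-! ### The models -/

section Models

variable {X : Type*} [MeasurableSpace X] {d k : ℕ}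

/-- The moment conditions on a target distribution `Q`. -/
structure MomentConditions (μ : Measure (Dose d)) (sd L cμ : ℝ) (Q : Measure (Unit3 X d))
    [IsFiniteMeasure Q] : Prop where
  /-- Bounded conditional mean. -/
  bounded_mean : ∀ᵐ z ∂((xLaw Q).prod μ), |outcomeMean Q z.1 z.2| ≤ 1
  /-- Sub-exponential tails. -/
  subexponential : ∀ᵐ z ∂(xaLaw Q), ∀ m : ℕ, 2 ≤ m →
    ∫⁻ y, ENNReal.ofReal (|y - cdrf Q z.2| ^ m) ∂(yGivenXA Q z) ≤
      ENNReal.ofReal (1 / 2 * (m.factorial : ℝ) * sd ^ 2 * L ^ (m - 2))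
  /-- Bounded density ratio between `μ` and the conditional law of `A` given `X`. -/
  density_ratio : ∀ᵐ x ∂(xLaw Q), μ ≪ aGivenX Q x ∧
    ∀ᵐ a ∂(aGivenX Q x), ENNReal.ofReal cμ⁻¹ ≤ μ.rnDeriv (aGivenX Q x) a ∧
      μ.rnDeriv (aGivenX Q x) a ≤ ENNReal.ofReal cμ

/-- The target model: all distributions of `(X, A, Y)` that satisfy the moment conditions and whose
dose response function satisfies the source condition. -/
def targetModel (X : Type*) [MeasurableSpace X] {d : ℕ}
    (H : Type*) [NormedAddCommGroup H] [InnerProductSpace ℝ H] [CompleteSpace H]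
    [RKHS ℝ H (Dose d) ℝ] {μ : Measure (Dose d)} (ev : ℕ → ℝ) (ef : ℕ → Lp ℝ 2 μ)
    (α R sd L cμ : ℝ) : Set (ProbabilityMeasure (Unit3 X d)) :=
  {Q | MomentConditions μ sd L cμ (Q : Measure (Unit3 X d)) ∧
    SourceCondition H ev ef α R (cdrf (Q : Measure (Unit3 X d)))}

/-- The data fusion conditions linking the observed distribution `P` to the target distribution
`Q`. Conditions given `S = s` are imposed on the sources of positive probability, where the
conditional law is defined. -/
structure FusionConditions (SX SY : Finset (Fin k)) (Mξ Mη c₁ : ℝ) (P : Measure (Obs X d k))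
    (Q : Measure (Unit3 X d)) [IsFiniteMeasure Q] : Prop where
  /-- Positive correctly aligned sources. -/
  prob_SX : Mξ⁻¹ ≤ P.real (sourceIn X d SX)
  prob_SY : Mη⁻¹ ≤ P.real (sourceIn X d SY)
  /-- Sufficient overlap. -/
  overlap_ac : ∀ s ∈ SY, P (sourceIn X d {s}) ≠ 0 → xaLaw Q ≪ xaLaw (lawGiven P {s})
  overlap_ratio : ∀ᵐ z ∂(xaLaw Q),
    ENNReal.ofReal c₁⁻¹ ≤ (xaLaw Q).rnDeriv (xaLaw (lawGiven P SY)) z ∧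
      (xaLaw Q).rnDeriv (xaLaw (lawGiven P SY)) z ≤ ENNReal.ofReal c₁
  /-- Exchangeability of conditionals. -/
  align_X : ∀ s ∈ SX, P (sourceIn X d {s}) ≠ 0 → xLaw (lawGiven P {s}) = xLaw Q
  align_Y : ∀ s ∈ SY, P (sourceIn X d {s}) ≠ 0 →
    ∀ᵐ z ∂(xaLaw Q), yGivenXA (lawGiven P {s}) z = yGivenXA Q z

/-- The statistical model: all distributions of `(X, A, Y, S)` that satisfy the data fusion
conditions with some member of the target model `𝒬`. -/
def fusionModel (SX SY : Finset (Fin k)) (Mξ Mη c₁ : ℝ)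
    (𝒬 : Set (ProbabilityMeasure (Unit3 X d))) : Set (ProbabilityMeasure (Obs X d k)) :=
  {P | ∃ Q ∈ 𝒬, FusionConditions SX SY Mξ Mη c₁ (P : Measure (Obs X d k))
    (Q : Measure (Unit3 X d))}

end Models

/-! ### Nuisance parameters, loss and risk -/

/-- A nuisance tuple `(ξ, η, w, m, τ)`. -/
structure Nuisance (X : Type*) (d : ℕ) where
  ξ : ℝ
  η : ℝ
  w : X → Dose d → ℝ
  m : X → Dose d → ℝ
  τ : Dose d → ℝ

section Risk

variable {X : Type*} [MeasurableSpace X] {d k : ℕ}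

/-- The true nuisance `g₀` of `P`:
`ξ₀ = 1 / P(S ∈ SX)`, `η₀ = 1 / P(S ∈ SY)`,
`w₀(x, a) = p(x | S ∈ SX) / p(x | S ∈ SY) * (1 / p(a | x, S ∈ SY))`, the last density being with
respect to `μ`, `m₀(x, a) = E[Y | X = x, A = a, S ∈ SY]` and
`θ₀(a) = E[m₀(X, a) | S ∈ SX]`. -/
def trueNuisance (μ : Measure (Dose d)) (SX SY : Finset (Fin k)) (P : Measure (Obs X d k)) :
    Nuisance X d where
  ξ := 1 / P.real (sourceIn X d SX)
  η := 1 / P.real (sourceIn X d SY)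
  w := fun x a =>
    ((xLaw (lawGiven P SX)).rnDeriv (xLaw (lawGiven P SY)) x).toReal *
      (1 / (Kernel.rnDeriv (aGivenX (lawGiven P SY)) (Kernel.const X μ) x a).toReal)
  m := outcomeMean (lawGiven P SY)
  τ := fun a => ∫ x, outcomeMean (lawGiven P SY) x a ∂(xLaw (lawGiven P SX))

/-- The loss at the point `((x, a, y, s), b)`. -/
def loss (SX SY : Finset (Fin k)) (θ : Dose d → ℝ) (g : Nuisance X d)
    (z : Obs X d k × Dose d) : ℝ :=
  let x := z.1.1
  let a := z.1.2.1
  let y := z.1.2.2.1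
  let s := z.1.2.2.2
  let b := z.2
  (θ b - g.τ b) ^ 2
    + 2 * g.ξ * (if s ∈ SX then 1 else 0) * (θ b - g.τ b) * (g.τ b - g.m x b)
    + 2 * g.η * g.w x a * (if s ∈ SY then 1 else 0) * (θ a - g.τ a) * (g.m x a - y)

/-- The expected loss `L_P(θ, g)` under `P × μ`. -/
def risk (μ : Measure (Dose d)) (SX SY : Finset (Fin k)) (P : Measure (Obs X d k))
    (θ : Dose d → ℝ) (g : Nuisance X d) : ℝ :=
  ∫ z, loss SX SY θ g z ∂(P.prod μ)

/-! ### Estimators without data fusion -/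

/-- Keep `(x, a, y)` for the observations with `s ∈ T`, erase all the others. -/
def keepAligned {n : ℕ} (T : Finset (Fin k)) (D : Fin n → Obs X d k) (i : Fin n) :
    Unit3 X d ⊕ Unit :=
  if (D i).2.2.2 ∈ T then Sum.inl ((D i).1, (D i).2.1, (D i).2.2.1) else Sum.inr ()

/-- The σ-algebra on samples generated by the `(X_i, A_i, Y_i)` with `S_i ∈ T`. -/
abbrev alignedSigma (X : Type*) [MeasurableSpace X] (d : ℕ) {k : ℕ} (n : ℕ) (T : Finset (Fin k)) :
    MeasurableSpace (Fin n → Obs X d k) :=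
  MeasurableSpace.comap (keepAligned T) inferInstance

/-- An estimator that does not use data fusion: it maps a sample to a function in `L²(μ)`, in a way
that is measurable with respect to the σ-algebra generated by the `(X_i, A_i, Y_i)` with
`S_i ∈ SX ∩ SY`. -/
structure IsNoFusionEstimator {n : ℕ} (μ : Measure (Dose d)) (SX SY : Finset (Fin k))
    (θ : (Fin n → Obs X d k) → Dose d → ℝ) : Prop where
  memLp : ∀ D, MemLp (θ D) 2 μ
  measurable : Measurable[(alignedSigma X d n (SX ∩ SY)).prod inferInstance]
    fun q : (Fin n → Obs X d k) × Dose d => θ q.1 q.2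

end Risk

/-- The sample size threshold `N_δ`. -/
def sampleThreshold (α p δ : ℝ) : ℝ :=
  1 / 4 * (√(3 * Real.log (2 / δ) + 4 * (δ / 32) ^ (-1 - (1 - 2 * α) / p))
    - √(3 * Real.log (2 / δ))) ^ 2

end DataFusion

end

/-! The proof is an Assouad-type argument over the sign vectors `v` of a cube, with regressions `∑ j
< m, ± ε * ef j`. Under every alternative, `X` is constant, `A ∼ μ`, the outcome takes the two
values `± b` with conditional mean `θ A`, and the source is independent of `(X, A, Y)`. All sources
then have the same conditional law, so the fusion conditions hold with density ratio one. The weight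
`w₀` is one and `m₀ = θ₀` almost everywhere; the corrections in the loss integrate to zero, and the
risk is the squared `L²(μ)` distance to `θ` (`risk_obsLaw`).

An estimator without fusion sees only the kept observations. Relative to zero regression, the
likelihood ratio of one of them has second moment `1 + ρ(T) ε² m / b²`, where `ρ(T)` is the
probability of being kept (`lintegral_keptTilt_sq`). Hence `n` of them carry the information of
`n_XY = n ρ(T)` aligned observations, and the `n`-fold second moment is at most `exp (m / 10)` when
`n_XY ε² m / b² ≤ m / 10`.

By Parseval, two vertices within squared distance `ε² m / 8` of the same function differ in at most
`m / 8` signs. So each sample makes the estimator close to at most a fraction `(3 / 4) ^ m` of the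
vertices (`card_hamming_ball_le`). Averaging this under the null law and changing measure through
the second moment yields one vertex that is approached with probability at most `2 δ`
(`exists_signResponse_pi_le`).

With `t = (1 - 2α) / p`, the choices `m ≈ n_XY ^ (1 / (1 + t))` and `ε² ≈ m ^ (-(1 + t))` respect
both the information budget and the source condition (`sourceCondition_sum`). The separation `ε² m ≈
m ^ (-t)` is then of order `n_XY ^ (-ρ)`. The sample threshold ensures `m ≥ 16 / δ`, which makes the
exponential factors smaller than `δ²`. -/

namespace DataFusion

/-! ### Likelihood ratios of product measures and change of measure -/

section ProductDensity

variable {Z : Type*} [MeasurableSpace Z]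

theorem lintegral_pi_prod {n : ℕ} (ν : Measure Z) [IsProbabilityMeasure ν]
    (f : Fin n → Z → ℝ≥0∞) (hf : ∀ i, Measurable (f i)) :
    ∫⁻ ω, ∏ i, f i (ω i) ∂(Measure.pi fun _ : Fin n => ν) = ∏ i, ∫⁻ z, f i z ∂ν := by
  have hind : iIndepFun (fun i (ω : Fin n → Z) => f i (ω i)) (Measure.pi fun _ : Fin n => ν) :=
    iIndepFun_pi fun i => (hf i).aemeasurable
  rw [lintegral_prod_eq_prod_lintegral_of_indepFun Finset.univ
    (fun i (ω : Fin n → Z) => f i (ω i)) hind (fun i => (hf i).comp (measurable_pi_apply i))]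
  refine Finset.prod_congr rfl fun i _ => ?_
  have h := (measurePreserving_eval (fun _ : Fin n => ν) i)
  exact h.lintegral_comp (hf i)

theorem pi_withDensity {n : ℕ} (ν : Measure Z) [IsProbabilityMeasure ν]
    (f : Z → ℝ≥0∞) (hf : Measurable f) [SigmaFinite (ν.withDensity f)] :
    (Measure.pi fun _ : Fin n => ν.withDensity f) =
      (Measure.pi fun _ : Fin n => ν).withDensity fun ω => ∏ i, f (ω i) := by
  refine Measure.pi_eq (μ := fun _ : Fin n => ν.withDensity f) fun s hs => ?_
  rw [withDensity_apply _ (MeasurableSet.univ_pi hs),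
    ← lintegral_indicator (MeasurableSet.univ_pi hs)]
  have h : ∀ ω : Fin n → Z, (Set.univ.pi s).indicator (fun ω => ∏ i, f (ω i)) ω =
      ∏ i, (s i).indicator f (ω i) := by
    intro ω
    by_cases hω : ω ∈ Set.univ.pi s
    · rw [Set.indicator_of_mem hω]
      exact Finset.prod_congr rfl fun i _ =>
        (Set.indicator_of_mem (hω i (Set.mem_univ i)) f).symm
    · rw [Set.indicator_of_notMem hω]
      simp only [Set.mem_pi, Set.mem_univ, true_implies, not_forall] at hω
      obtain ⟨i, hi⟩ := hω
      exact (Finset.prod_eq_zero (Finset.mem_univ i) (Set.indicator_of_notMem hi f)).symm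
  simp_rw [h]
  rw [lintegral_pi_prod ν _ fun i => hf.indicator (hs i)]
  refine Finset.prod_congr rfl fun i _ => ?_
  rw [lintegral_indicator (hs i), withDensity_apply _ (hs i)]

/-- This is `(l x - 1)² ≥ 0`. The free parameter `l` takes the place of Cauchy–Schwarz in the change
of measure and is later tuned to balance the two error terms. -/
theorem le_half_mul_sq_add (l : ℝ) (hl : 0 < l) (x : ℝ≥0∞) :
    x ≤ ENNReal.ofReal (l / 2) * x ^ 2 + ENNReal.ofReal (1 / (2 * l)) := by
  induction x with
  | top => simp [ENNReal.mul_top, hl]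
  | coe x =>
    have h : (x : ℝ) ≤ l / 2 * (x : ℝ) ^ 2 + 1 / (2 * l) := by
      have : l / 2 * (x : ℝ) ^ 2 + 1 / (2 * l) - x = (l * x - 1) ^ 2 / (2 * l) := by
        field_simp
        ring
      have : 0 ≤ (l * (x : ℝ) - 1) ^ 2 / (2 * l) := by positivity
      linarith
    have hx : (x : ℝ≥0∞) = ENNReal.ofReal (x : ℝ) := by simp
    rw [hx, ← ENNReal.ofReal_pow (by positivity), ← ENNReal.ofReal_mul (by positivity),
      ← ENNReal.ofReal_add (by positivity) (by positivity)]
    exact ENNReal.ofReal_le_ofReal h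

/-- The linear-quadratic bound is applied to the product density on `s`. The quadratic term is then
integrated over the whole space, where independence turns it into a power of the second moment of
one factor. -/
theorem pi_withDensity_apply_le {n : ℕ} (ν : Measure Z) [IsProbabilityMeasure ν]
    (f : Z → ℝ≥0∞) (hf : Measurable f) [SigmaFinite (ν.withDensity f)] (l : ℝ) (hl : 0 < l)
    {s : Set (Fin n → Z)} (hs : MeasurableSet s) :
    (Measure.pi fun _ : Fin n => ν.withDensity f) s ≤
      ENNReal.ofReal (l / 2) * (∫⁻ z, f z ^ 2 ∂ν) ^ n +
        ENNReal.ofReal (1 / (2 * l)) * (Measure.pi fun _ : Fin n => ν) s := by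
  have hm : Measurable fun ω : Fin n → Z => ∏ i, f (ω i) :=
    Finset.measurable_prod _ fun i _ => hf.comp (measurable_pi_apply i)
  rw [pi_withDensity ν f hf, withDensity_apply _ hs]
  calc ∫⁻ ω in s, ∏ i, f (ω i) ∂(Measure.pi fun _ : Fin n => ν)
      ≤ ∫⁻ ω in s, (ENNReal.ofReal (l / 2) * (∏ i, f (ω i)) ^ 2 + ENNReal.ofReal (1 / (2 * l)))
          ∂(Measure.pi fun _ : Fin n => ν) :=
        lintegral_mono fun ω => le_half_mul_sq_add l hl _
    _ = (∫⁻ ω in s, ENNReal.ofReal (l / 2) * (∏ i, f (ω i)) ^ 2 ∂(Measure.pi fun _ : Fin n => ν))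
          + ENNReal.ofReal (1 / (2 * l)) * (Measure.pi fun _ : Fin n => ν) s := by
        rw [lintegral_add_right _ measurable_const]
        simp
    _ ≤ _ := by
        gcongr
        refine (setLIntegral_le_lintegral _ _).trans ?_
        rw [lintegral_const_mul _ (hm.pow_const 2)]
        simp_rw [← Finset.prod_pow]
        rw [lintegral_pi_prod ν (fun _ z => f z ^ 2) fun _ => hf.pow_const 2]
        simp

/-- If every point lies in at most a fraction `r` of finitely many events, their probabilities
are at most `r` on average. -/
theorem sum_measure_le_of_card_le {V : Type*} [Fintype V] (P : Measure Z) [IsProbabilityMeasure P]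
    (s : V → Set Z) (hs : ∀ v, MeasurableSet (s v)) (r : ℝ)
    (hover : ∀ ω, (Nat.card {v // ω ∈ s v} : ℝ) ≤ r * Fintype.card V) :
    ∑ v, P (s v) ≤ ENNReal.ofReal (r * Fintype.card V) := by
  classical
  have h1 : ∀ v, P (s v) = ∫⁻ ω, (s v).indicator 1 ω ∂P := fun v =>
    (lintegral_indicator_one (hs v)).symm
  simp_rw [h1]
  rw [← lintegral_finsetSum _ fun v _ => measurable_one.indicator (hs v)]
  -- Double counting: the sum of the indicators at `ω` is the number of events containing `ω`.
  have h2 : ∀ ω, ∑ v, (s v).indicator (1 : Z → ℝ≥0∞) ω ≤ ENNReal.ofReal (r * Fintype.card V) := by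
    intro ω
    have h3 : ∑ v, (s v).indicator (1 : Z → ℝ≥0∞) ω =
        ((Nat.card {v // ω ∈ s v} : ℕ) : ℝ≥0∞) := by
      simp [Set.indicator_apply, Finset.sum_boole, Fintype.card_subtype]
    rw [h3, ← ENNReal.ofReal_natCast]
    exact ENNReal.ofReal_le_ofReal (hover ω)
  calc _ ≤ ∫⁻ _, ENNReal.ofReal (r * Fintype.card V) ∂P := lintegral_mono h2
    _ = _ := by simp

/-- Among finitely many product measures with bounded second moments of the likelihood ratios, and
events of small average probability under the dominating measure, one gives its event a small
probability. -/
theorem exists_pi_withDensity_apply_le {n : ℕ} {V : Type*} [Fintype V] [Nonempty V]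
    (ν : Measure Z) [IsProbabilityMeasure ν]
    (f : V → Z → ℝ≥0∞) (hf : ∀ v, Measurable (f v))
    (hfp : ∀ v, IsProbabilityMeasure (ν.withDensity (f v)))
    (s : V → Set (Fin n → Z)) (hs : ∀ v, MeasurableSet (s v))
    (l : ℝ) (hl : 0 < l) (C r : ℝ) (hC : 0 ≤ C) (hr : 0 ≤ r)
    (hchi : ∀ v, (∫⁻ z, f v z ^ 2 ∂ν) ^ n ≤ ENNReal.ofReal C)
    (hsum : ∑ v, (Measure.pi fun _ : Fin n => ν) (s v) ≤ ENNReal.ofReal (r * Fintype.card V)) :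
    ∃ v, (Measure.pi fun _ : Fin n => ν.withDensity (f v)) (s v) ≤
      ENNReal.ofReal (l / 2 * C + 1 / (2 * l) * r) := by
  set P := Measure.pi fun _ : Fin n => ν
  -- If every event exceeded the bound, so would the average over `v`, where the null probabilities
  -- sum to at most `r * card V`.
  by_contra! hcon
  have hbound : ∑ v, (Measure.pi fun _ : Fin n => ν.withDensity (f v)) (s v) ≤
      ∑ _v : V, ENNReal.ofReal (l / 2 * C + 1 / (2 * l) * r) := by
    calc _ ≤ ∑ v, (ENNReal.ofReal (l / 2) * ENNReal.ofReal C +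
          ENNReal.ofReal (1 / (2 * l)) * P (s v)) := by
          refine Finset.sum_le_sum fun v _ => ?_
          refine (pi_withDensity_apply_le ν (f v) (hf v) l hl (hs v)).trans ?_
          gcongr
          exact hchi v
      _ = Fintype.card V * (ENNReal.ofReal (l / 2) * ENNReal.ofReal C) +
          ENNReal.ofReal (1 / (2 * l)) * ∑ v, P (s v) := by
          rw [Finset.sum_add_distrib, ← Finset.mul_sum _ _ (ENNReal.ofReal (1 / (2 * l))),
            Finset.sum_const, Finset.card_univ, nsmul_eq_mul]
      _ ≤ Fintype.card V * (ENNReal.ofReal (l / 2) * ENNReal.ofReal C) +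
          ENNReal.ofReal (1 / (2 * l)) * ENNReal.ofReal (r * Fintype.card V) := by gcongr
      _ = _ := by
          rw [Finset.sum_const, Finset.card_univ, nsmul_eq_mul,
            ENNReal.ofReal_add (by positivity) (by positivity),
            ENNReal.ofReal_mul (p := l / 2) (by positivity),
            ENNReal.ofReal_mul (p := 1 / (2 * l)) (by positivity),
            ENNReal.ofReal_mul hr, ENNReal.ofReal_natCast]
          ring
  refine absurd hbound (not_le.mpr ?_)
  refine ENNReal.sum_lt_sum_of_nonempty Finset.univ_nonempty fun v _ => hcon v

end ProductDensity

/-- The Hamming ball of radius `m / 8` in the cube `{0, 1} ^ m` has at most `(3 / 2) ^ m` points. -/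
theorem card_hamming_ball_le {m : ℕ} (w : Fin m → Bool) :
    (Nat.card {v : Fin m → Bool // 8 * hammingDist v w ≤ m} : ℝ) ≤
      (3 / 4) ^ m * Fintype.card (Fin m → Bool) := by
  classical
  -- Chernoff bound: the weight `(3/4) ^ (8 * distance)` is at least `(3/4) ^ m` on the ball, and
  -- its total over the cube factorizes over the coordinates.
  have key : ∑ v : Fin m → Bool, ((3 : ℝ) / 4) ^ (8 * hammingDist v w) =
      (1 + (3 / 4) ^ 8) ^ m := by
    have h1 : ∀ v : Fin m → Bool, ((3 : ℝ) / 4) ^ (8 * hammingDist v w) =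
        ∏ j, (if v j ≠ w j then ((3 : ℝ) / 4) ^ 8 else 1) := by
      intro v
      rw [Finset.prod_ite]
      simp [hammingDist, pow_mul]
    simp_rw [h1]
    have h2 := Finset.prod_univ_sum (fun _ : Fin m => (Finset.univ : Finset Bool))
      (fun j b => if b ≠ w j then ((3 : ℝ) / 4) ^ 8 else 1)
    rw [Fintype.piFinset_univ] at h2
    rw [← h2]
    have h3 : ∀ j : Fin m, ∑ b : Bool, (if b ≠ w j then ((3 : ℝ) / 4) ^ 8 else 1) =
        1 + (3 / 4) ^ 8 := by
      intro j
      cases w j <;> simp [add_comm]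
    simp_rw [h3]
    simp
  have h4 : (Nat.card {v : Fin m → Bool // 8 * hammingDist v w ≤ m} : ℝ) * (3 / 4) ^ m ≤
      ∑ v : Fin m → Bool, ((3 : ℝ) / 4) ^ (8 * hammingDist v w) := by
    rw [Nat.card_eq_fintype_card, Fintype.card_subtype, ← nsmul_eq_mul]
    calc _ = ∑ v ∈ Finset.univ.filter fun v : Fin m → Bool => 8 * hammingDist v w ≤ m,
          ((3 : ℝ) / 4) ^ m := by rw [Finset.sum_const]
      _ ≤ ∑ v ∈ Finset.univ.filter fun v : Fin m → Bool => 8 * hammingDist v w ≤ m,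
          ((3 : ℝ) / 4) ^ (8 * hammingDist v w) := by
          refine Finset.sum_le_sum fun v hv => ?_
          exact pow_le_pow_of_le_one (by norm_num) (by norm_num) (Finset.mem_filter.mp hv).2
      _ ≤ _ := Finset.sum_le_sum_of_subset_of_nonneg (Finset.filter_subset _ _)
          fun _ _ _ => by positivity
  rw [key] at h4
  -- Numerically `1 + (3/4)^8 ≈ 1.1001 ≤ 9/8`.
  have h5 : (1 + ((3 : ℝ) / 4) ^ 8) ^ m ≤ ((3 / 4) * 2 * (3 / 4)) ^ m := by
    gcongr
    norm_num
  have h6 : (Nat.card {v : Fin m → Bool // 8 * hammingDist v w ≤ m} : ℝ) * (3 / 4) ^ m ≤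
      ((3 / 4) ^ m * 2 ^ m) * (3 / 4) ^ m := by
    rw [← mul_pow, ← mul_pow]
    exact h4.trans h5
  have h7 := le_of_mul_le_mul_right h6 (by positivity)
  simpa using h7

/-! ### Eigenfunctions in the reproducing kernel Hilbert space and the source condition -/

section Source

variable {d : ℕ} {H : Type*} [NormedAddCommGroup H] [InnerProductSpace ℝ H] [CompleteSpace H]
  [RKHS ℝ H (Dose d) ℝ]

theorem inner_kerFun_one (a : Dose d) (h : H) : inner ℝ (RKHS.kerFun H a (1 : ℝ)) h = h a := by
  rw [RKHS.kerFun_inner]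
  simp

theorem inner_kerFun_kerFun (a t : Dose d) :
    inner ℝ (RKHS.kerFun H a (1 : ℝ)) (RKHS.kerFun H t (1 : ℝ)) = reprKernel H a t := by
  rw [inner_kerFun_one, RKHS.kerFun_apply, reprKernel]

/-- The squared `H`-distance of two kernel sections is `K(t,t) - 2 K(t,s) + K(s,s)`. Continuity on
the compact cube bounds the sections and makes the integral defining `kernelMean` converge in `H`.
-/
theorem KernelCondition.continuous_kerFun (hK : KernelCondition (d := d) H) :
    Continuous fun t : Dose d => RKHS.kerFun H t (1 : ℝ) := by
  rw [continuous_iff_continuousAt]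
  intro s
  rw [ContinuousAt, tendsto_iff_norm_sub_tendsto_zero]
  have h : ∀ t : Dose d, ‖RKHS.kerFun H t (1 : ℝ) - RKHS.kerFun H s (1 : ℝ)‖ =
      √(reprKernel H t t - 2 * reprKernel H t s + reprKernel H s s) := by
    intro t
    rw [← inner_kerFun_kerFun, ← inner_kerFun_kerFun, ← inner_kerFun_kerFun,
      real_inner_self_eq_norm_sq, real_inner_self_eq_norm_sq, ← norm_sub_sq_real,
      Real.sqrt_sq (norm_nonneg _)]
  simp_rw [h]
  have hc : Continuous fun t : Dose d =>
      √(reprKernel H t t - 2 * reprKernel H t s + reprKernel H s s) := by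
    have h1 : Continuous fun t : Dose d => reprKernel H t t :=
      Continuous.comp (g := fun q : Dose d × Dose d => reprKernel H q.1 q.2)
        (f := fun t => (t, t)) hK.continuous (continuous_id.prodMk continuous_id)
    have h2 : Continuous fun t : Dose d => reprKernel H t s :=
      Continuous.comp (g := fun q : Dose d × Dose d => reprKernel H q.1 q.2)
        (f := fun t => (t, s)) hK.continuous (continuous_id.prodMk continuous_const)
    exact Real.continuous_sqrt.comp ((h1.sub (continuous_const.mul h2)).add continuous_const)
  have h0 := hc.tendsto s
  have h1 : √(reprKernel H s s - 2 * reprKernel H s s + reprKernel H s s) = 0 := by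
    rw [show reprKernel H s s - 2 * reprKernel H s s + reprKernel H s s = 0 by ring, Real.sqrt_zero]
  rwa [h1] at h0

variable {μ : Measure (Dose d)}

theorem KernelCondition.integrable_smul_kerFun [IsProbabilityMeasure μ]
    (hK : KernelCondition (d := d) H) (f : Lp ℝ 2 μ) :
    Integrable (fun t => f t • RKHS.kerFun H t (1 : ℝ)) μ := by
  obtain ⟨C, hC⟩ := isCompact_univ.exists_bound_of_continuousOn hK.continuous_kerFun.continuousOn
  have hf : Integrable f μ := (Lp.memLp f).integrable one_le_two
  refine (hf.norm.mul_const C).mono' (hf.1.smul hK.continuous_kerFun.aestronglyMeasurable) ?_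
  refine Filter.Eventually.of_forall fun t => ?_
  rw [norm_smul]
  exact mul_le_mul_of_nonneg_left (hC t (Set.mem_univ t)) (norm_nonneg _)

variable (H) in
/-- The element `∫ f(t) K(·, t) μ(dt)` of the reproducing kernel Hilbert space. -/
noncomputable def kernelMean (f : Lp ℝ 2 μ) : H := ∫ t, f t • RKHS.kerFun H t (1 : ℝ) ∂μ

theorem KernelCondition.inner_kernelMean [IsProbabilityMeasure μ]
    (hK : KernelCondition (d := d) H) (f : Lp ℝ 2 μ) (h : H) :
    inner ℝ h (kernelMean H f) = ∫ t, f t * h t ∂μ := by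
  rw [kernelMean, ← integral_inner (hK.integrable_smul_kerFun f)]
  refine integral_congr_ae (Filter.Eventually.of_forall fun t => ?_)
  simp only
  rw [real_inner_smul_right, real_inner_comm, inner_kerFun_one]

theorem KernelCondition.kernelMean_apply [IsProbabilityMeasure μ]
    (hK : KernelCondition (d := d) H) (f : Lp ℝ 2 μ)
    (a : Dose d) : kernelMean H f a = ∫ t, reprKernel H a t * f t ∂μ := by
  rw [← inner_kerFun_one a (kernelMean H f), hK.inner_kernelMean]
  refine integral_congr_ae (Filter.Eventually.of_forall fun t => ?_)
  simp only
  rw [← inner_kerFun_kerFun, real_inner_comm, inner_kerFun_one, mul_comm]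

variable {ev : ℕ → ℝ} {ef : ℕ → Lp ℝ 2 μ}

/-- Orthonormality leaves only the term `j` of the spectral series at `ef j`. Thus `kernelMean H (ef
j)` is a genuine element of `H` in the class of `ev j • ef j`. -/
theorem IsSpectralDecomposition.kernelMean_ae_eq [IsProbabilityMeasure μ]
    (hspec : IsSpectralDecomposition H μ ev ef)
    (hK : KernelCondition (d := d) H) (j : ℕ) :
    ⇑(kernelMean H (ef j)) =ᵐ[μ] fun a => ev j * ef j a := by
  obtain ⟨g, hg, hsum⟩ := hspec.decomposition (ef j)
  have h1 : HasSum (fun i => (ev i * inner ℝ (ef i) (ef j)) • ef i) (ev j • ef j) := by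
    have h2 := hasSum_single (f := fun i => (ev i * inner ℝ (ef i) (ef j)) • ef i) j
      (fun i hi => by simp [hspec.orthonormal.2 hi])
    simpa [real_inner_self_eq_norm_sq, hspec.orthonormal.1 j] using h2
  have h3 : g = ev j • ef j := hsum.unique h1
  filter_upwards [hg, Lp.coeFn_smul (ev j) (ef j)] with a ha hb
  rw [hK.kernelMean_apply, ← ha, h3, hb]
  simp

theorem inner_eq_integral_mul (f g : Lp ℝ 2 μ) : inner ℝ f g = ∫ a, f a * g a ∂μ := by
  rw [L2.inner_def]
  refine integral_congr_ae (Filter.Eventually.of_forall fun t => ?_)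
  simp [mul_comm]

/-- The reproducing property turns the `H`-inner product into the `L²` pairing of `ef j` with `ev i
• ef i`. This makes `H`-norms of finite combinations explicit. -/
theorem IsSpectralDecomposition.inner_kernelMean [IsProbabilityMeasure μ]
    (hspec : IsSpectralDecomposition H μ ev ef)
    (hK : KernelCondition (d := d) H) (i j : ℕ) :
    inner ℝ (kernelMean H (ef i)) (kernelMean H (ef j)) = if i = j then ev i else 0 := by
  have h : ∫ t, ef j t * kernelMean H (ef i) t ∂μ = ev i * inner ℝ (ef i) (ef j) := by
    rw [inner_eq_integral_mul, ← integral_const_mul]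
    refine integral_congr_ae ?_
    filter_upwards [hspec.kernelMean_ae_eq hK i] with a ha
    rw [ha]
    ring
  rw [hK.inner_kernelMean, h, orthonormal_iff_ite.mp hspec.orthonormal i j]
  split_ifs <;> simp

theorem coeFn_sum_smul (m : ℕ) (c : ℕ → ℝ) :
    ⇑(∑ j ∈ Finset.range m, c j • ef j) =ᵐ[μ] fun a => ∑ j ∈ Finset.range m, c j * ef j a := by
  have h1 := Lp.coeFn_finsetSum (Finset.range m) fun j => c j • ef j
  have h2 : ∀ᵐ a ∂μ, ∀ j, (c j • ef j : Lp ℝ 2 μ) a = c j * ef j a := by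
    rw [ae_all_iff]
    intro j
    filter_upwards [Lp.coeFn_smul (c j) (ef j)] with a ha
    rw [ha]
    simp
  filter_upwards [h1, h2] with a h1 h2
  rw [h1]
  simp [h2]

theorem powerOp_sum_smul (hef : Orthonormal ℝ ef) (s : ℝ) (m : ℕ) (c : ℕ → ℝ) :
    powerOp ev ef s (∑ j ∈ Finset.range m, c j • ef j) =
      ∑ j ∈ Finset.range m, (c j * ev j ^ s) • ef j := by
  have hin : ∀ i, inner ℝ (ef i) (∑ j ∈ Finset.range m, c j • ef j) =
      if i ∈ Finset.range m then c i else 0 := by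
    intro i
    rw [inner_sum]
    simp_rw [real_inner_smul_right, orthonormal_iff_ite.mp hef i]
    simp
  rw [powerOp, tsum_eq_sum (s := Finset.range m)]
  · refine Finset.sum_congr rfl fun i hi => ?_
    rw [hin, if_pos hi, mul_comm]
  · intro i hi
    rw [hin, if_neg hi]
    simp

/-- A finite combination of eigenfunctions satisfies the source condition if its weighted
`ℓ²`-norm is at most `R`. -/
theorem IsSpectralDecomposition.sourceCondition_sum [IsProbabilityMeasure μ]
    (hspec : IsSpectralDecomposition H μ ev ef)
    (hK : KernelCondition (d := d) H) (hev : ∀ j, 0 < ev j) {α R : ℝ} (hR : 0 ≤ R)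
    {m : ℕ} {c : ℕ → ℝ} {θ : Dose d → ℝ}
    (hθ : θ =ᵐ[μ] fun a => ∑ j ∈ Finset.range m, c j * ef j a)
    (hc : ∑ j ∈ Finset.range m, c j ^ 2 * ev j ^ (2 * α - 1) ≤ R ^ 2) :
    SourceCondition H ev ef α R θ := by
  refine ⟨∑ j ∈ Finset.range m, c j • ef j, (coeFn_sum_smul m c).trans hθ.symm,
    -- `T ^ α θ` has coefficients `c j * ev j ^ α`, and `ef j` is represented in `H` by `(ev j)⁻¹ •
    -- kernelMean H (ef j)`; hence the exponent `α - 1`.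
    ∑ j ∈ Finset.range m, (c j * ev j ^ (α - 1)) • kernelMean H (ef j), ?_, ?_⟩
  · rw [powerOp_sum_smul hspec.orthonormal]
    have h1 : ∀ᵐ a ∂μ, ∀ j, kernelMean H (ef j) a = ev j * ef j a :=
      ae_all_iff.mpr fun j => hspec.kernelMean_ae_eq hK j
    filter_upwards [coeFn_sum_smul (ef := ef) m fun j => c j * ev j ^ α, h1] with a h2 h1
    rw [h2, ← RKHS.coeCLM_apply, map_sum, Finset.sum_apply]
    refine Finset.sum_congr rfl fun j _ => ?_
    rw [map_smul, RKHS.coeCLM_apply, Pi.smul_apply, h1, smul_eq_mul,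
      Real.rpow_sub_one (hev j).ne']
    field_simp [(hev j).ne']
  · rw [← abs_of_nonneg hR, ← abs_of_nonneg (norm_nonneg _), ← sq_le_sq,
      ← real_inner_self_eq_norm_sq]
    refine le_trans (le_of_eq ?_) hc
    rw [sum_inner]
    refine Finset.sum_congr rfl fun i hi => ?_
    rw [inner_sum]
    simp_rw [real_inner_smul_left, real_inner_smul_right, hspec.inner_kernelMean hK]
    simp only [mul_ite, mul_zero, Finset.sum_ite_eq, hi, if_true]
    -- The two coefficient factors combine with the squared norm `ev i` of `kernelMean H (ef i)`.
    have : ev i ^ (2 * α - 1) = ev i ^ (α - 1) * ev i ^ (α - 1) * ev i := by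
      rw [← Real.rpow_add (hev i), ← Real.rpow_add_one (hev i).ne']
      congr 1
      ring
    rw [this]
    ring

/-- Parseval for finite combinations of eigenfunctions. -/
theorem integral_sq_sum (hef : Orthonormal ℝ ef) (m : ℕ) (c : ℕ → ℝ)
    {θ : Dose d → ℝ} (hθ : θ =ᵐ[μ] fun a => ∑ j ∈ Finset.range m, c j * ef j a) :
    ∫ a, θ a ^ 2 ∂μ = ∑ j ∈ Finset.range m, c j ^ 2 := by
  have h1 : ∫ a, θ a ^ 2 ∂μ =
      inner ℝ (∑ j ∈ Finset.range m, c j • ef j) (∑ j ∈ Finset.range m, c j • ef j) := by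
    rw [inner_eq_integral_mul]
    refine integral_congr_ae ?_
    filter_upwards [hθ, coeFn_sum_smul (ef := ef) m c] with a h1 h2
    rw [h1, h2, sq]
  rw [h1, hef.inner_sum c c (Finset.range m)]
  simp [sq]

end Source

/-- A bounded measurable regression function `θ`, together with an outcome scale `b`. -/
structure BinaryResponse (d : ℕ) where
  b : ℝ
  θ : Dose d → ℝ
  b_pos : 0 < b
  measurable : Measurable θ
  bound : ∀ a, |θ a| ≤ b

/-! ### Target laws with two-valued outcomes -/

section Binary

variable {X : Type*} [MeasurableSpace X] {d k : ℕ}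

namespace BinaryResponse

/-- The response with vanishing regression function. -/
def null (r : BinaryResponse d) : BinaryResponse d where
  b := r.b
  θ := fun _ => 0
  b_pos := r.b_pos
  measurable := measurable_const
  bound := fun _ => by simpa using r.b_pos.le

theorem neg_one_le (r : BinaryResponse d) (a : Dose d) : -1 ≤ r.θ a / r.b := by
  rw [le_div_iff₀ r.b_pos]
  linarith [(abs_le.mp (r.bound a)).1]

theorem le_one (r : BinaryResponse d) (a : Dose d) : r.θ a / r.b ≤ 1 := by
  rw [div_le_iff₀ r.b_pos]
  linarith [(abs_le.mp (r.bound a)).2]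

variable (X) in
/-- The kernel sending `(x, a)` to the law on `{b, -b}` with mean `θ a`. -/
noncomputable def kernel (r : BinaryResponse d) : Kernel (X × Dose d) ℝ where
  toFun z := ENNReal.ofReal ((1 + r.θ z.2 / r.b) / 2) • Measure.dirac r.b +
    ENNReal.ofReal ((1 - r.θ z.2 / r.b) / 2) • Measure.dirac (-r.b)
  measurable' := by
    have := r.measurable
    refine Measure.measurable_of_measurable_coe _ fun s _ => ?_
    simp only [Measure.add_apply, Measure.smul_apply, smul_eq_mul]
    fun_prop

theorem kernel_apply (r : BinaryResponse d) (z : X × Dose d) :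
    r.kernel X z = ENNReal.ofReal ((1 + r.θ z.2 / r.b) / 2) • Measure.dirac r.b +
      ENNReal.ofReal ((1 - r.θ z.2 / r.b) / 2) • Measure.dirac (-r.b) := rfl

instance (r : BinaryResponse d) : IsMarkovKernel (r.kernel X) where
  isProbabilityMeasure z := by
    constructor
    have h1 := r.neg_one_le z.2
    have h2 := r.le_one z.2
    simp only [kernel_apply, Measure.add_apply, Measure.smul_apply, measure_univ, smul_eq_mul,
      mul_one]
    rw [← ENNReal.ofReal_add (by linarith) (by linarith), ← ENNReal.ofReal_one]
    congr 1
    ring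

theorem lintegral_kernel (r : BinaryResponse d) (z : X × Dose d) (f : ℝ → ℝ≥0∞) :
    ∫⁻ y, f y ∂(r.kernel X z) = ENNReal.ofReal ((1 + r.θ z.2 / r.b) / 2) * f r.b +
      ENNReal.ofReal ((1 - r.θ z.2 / r.b) / 2) * f (-r.b) := by
  rw [kernel_apply, lintegral_add_measure, lintegral_smul_measure, lintegral_smul_measure,
    lintegral_dirac, lintegral_dirac]
  simp

theorem integral_kernel (r : BinaryResponse d) (z : X × Dose d) (f : ℝ → ℝ) :
    ∫ y, f y ∂(r.kernel X z) = (1 + r.θ z.2 / r.b) / 2 * f r.b +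
      (1 - r.θ z.2 / r.b) / 2 * f (-r.b) := by
  have h1 := r.neg_one_le z.2
  have h2 := r.le_one z.2
  have hi : ∀ y : ℝ, Integrable f (Measure.dirac y) := fun y => integrable_dirac (by simp)
  rw [kernel_apply, integral_add_measure ((hi _).smul_measure (by simp))
    ((hi _).smul_measure (by simp)), integral_smul_measure, integral_smul_measure,
    integral_dirac, integral_dirac, ENNReal.toReal_ofReal (by linarith),
    ENNReal.toReal_ofReal (by linarith), smul_eq_mul, smul_eq_mul]

theorem integral_kernel_id (r : BinaryResponse d) (z : X × Dose d) :
    ∫ y, y ∂(r.kernel X z) = r.θ z.2 := by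
  rw [r.integral_kernel z fun y => y]
  field_simp [r.b_pos.ne']
  ring

theorem ae_kernel_abs_le (r : BinaryResponse d) (z : X × Dose d) :
    ∀ᵐ y ∂(r.kernel X z), |y| ≤ r.b := by
  have h : MeasurableSet {y : ℝ | ¬ |y| ≤ r.b} :=
    (measurableSet_le measurable_id.abs measurable_const).compl
  rw [ae_iff, ← lintegral_indicator_one h, lintegral_kernel]
  simp [abs_of_pos r.b_pos]

/-- The law of `(X, A, Y)` with `X ∼ ν` and `A ∼ μ` independent and `Y ∈ {b, -b}` with conditional
mean `θ A`. -/
noncomputable def target (r : BinaryResponse d) (ν : Measure X) (μ : Measure (Dose d)) :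
    Measure (Unit3 X d) :=
  ((ν.prod μ) ⊗ₘ r.kernel X).map fun z => (z.1.1, z.1.2, z.2)

variable (r : BinaryResponse d) (ν : Measure X) (μ : Measure (Dose d))

theorem map_target_fst_pair : (r.target ν μ).map (fun z => ((z.1, z.2.1), z.2.2)) =
    (ν.prod μ) ⊗ₘ r.kernel X := by
  rw [target, Measure.map_map (by fun_prop) (by fun_prop)]
  exact Measure.map_id

theorem ae_target_abs_le : ∀ᵐ z ∂(r.target ν μ), |z.2.2| ≤ r.b := by
  have h : MeasurableSet {z : Unit3 X d | |z.2.2| ≤ r.b} :=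
    measurableSet_le (by fun_prop) measurable_const
  rw [target, ae_map_iff (by fun_prop) h]
  refine Measure.ae_compProd_of_ae_ae ?_ (Filter.Eventually.of_forall fun z => r.ae_kernel_abs_le z)
  exact measurableSet_le (by fun_prop) measurable_const

variable [IsProbabilityMeasure ν] [IsProbabilityMeasure μ]

instance : IsProbabilityMeasure (r.target ν μ) :=
  Measure.isProbabilityMeasure_map (by fun_prop)

theorem lintegral_target {f : Unit3 X d → ℝ≥0∞} (hf : Measurable f) :
    ∫⁻ z, f z ∂(r.target ν μ) = ∫⁻ z, (ENNReal.ofReal ((1 + r.θ z.2 / r.b) / 2) * f (z.1, z.2, r.b)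
      + ENNReal.ofReal ((1 - r.θ z.2 / r.b) / 2) * f (z.1, z.2, -r.b)) ∂(ν.prod μ) := by
  rw [target, lintegral_map hf (by fun_prop), Measure.lintegral_compProd (by fun_prop)]
  refine lintegral_congr fun z => ?_
  exact r.lintegral_kernel z fun y => f (z.1, z.2, y)

/-- The density of the law of `(X, A, Y)` with respect to the law with vanishing regression. -/
noncomputable def tilt (z : Unit3 X d) : ℝ≥0∞ := ENNReal.ofReal (1 + z.2.2 * r.θ z.2.1 / r.b ^ 2)

theorem measurable_tilt : Measurable (r.tilt (X := X)) := by
  have := r.measurable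
  unfold tilt
  fun_prop

/-- At `y = ± b` the density `1 + y θ / b²` is `1 ± θ / b`, the ratio of the probability `(1 ± θ /
b) / 2` to the null probability `1 / 2`. -/
theorem target_eq_withDensity :
    r.target ν μ = (r.null.target ν μ).withDensity r.tilt := by
  have hb := r.b_pos.ne'
  have hr := r.measurable
  ext s hs
  rw [withDensity_apply _ hs, ← lintegral_indicator hs, ← lintegral_indicator_one hs,
    lintegral_target _ _ _ (measurable_one.indicator hs),
    lintegral_target _ _ _ (r.measurable_tilt.indicator hs)]
  refine lintegral_congr fun z => ?_
  have h1 : ENNReal.ofReal ((1 + r.θ z.2 / r.b) / 2) =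
      ENNReal.ofReal ((1 + r.null.θ z.2 / r.null.b) / 2) * r.tilt (z.1, z.2, r.null.b) := by
    rw [tilt, ← ENNReal.ofReal_mul (by simp [null])]
    congr 1
    simp only [null]
    field_simp
    ring
  have h2 : ENNReal.ofReal ((1 - r.θ z.2 / r.b) / 2) =
      ENNReal.ofReal ((1 - r.null.θ z.2 / r.null.b) / 2) * r.tilt (z.1, z.2, -r.null.b) := by
    rw [tilt, ← ENNReal.ofReal_mul (by simp [null])]
    congr 1
    simp only [null]
    field_simp
    ring
  have h3 : ∀ (c : ℝ≥0∞) (w : Unit3 X d), c * r.tilt w * s.indicator 1 w =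
      c * s.indicator r.tilt w := by
    intro c w
    by_cases hw : w ∈ s <;> simp [hw]
  rw [h1, h2, ← h3, ← h3]
  rfl

/-- The mean of `(1 + θ / b)²` and `(1 - θ / b)²` is `1 + θ² / b²`: the chi-square divergence from
the null is `‖θ‖² / b²`. -/
theorem lintegral_tilt_sq :
    ∫⁻ z, r.tilt z ^ 2 ∂(r.null.target ν μ) =
      1 + ENNReal.ofReal ((∫ a, r.θ a ^ 2 ∂μ) / r.b ^ 2) := by
  have hb := r.b_pos.ne'
  have hr := r.measurable
  rw [lintegral_target _ _ _ (r.measurable_tilt.pow_const 2)]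
  have h1 : ∀ z : X × Dose d, ENNReal.ofReal ((1 + r.null.θ z.2 / r.null.b) / 2) *
      r.tilt (z.1, z.2, r.null.b) ^ 2 + ENNReal.ofReal ((1 - r.null.θ z.2 / r.null.b) / 2) *
      r.tilt (z.1, z.2, -r.null.b) ^ 2 = 1 + ENNReal.ofReal (r.θ z.2 ^ 2 / r.b ^ 2) := by
    intro z
    have h1 := r.neg_one_le z.2
    have h2 := r.le_one z.2
    have h3 : 1 + r.b * r.θ z.2 / r.b ^ 2 = 1 + r.θ z.2 / r.b := by field_simp
    have h4 : 1 + -r.b * r.θ z.2 / r.b ^ 2 = 1 - r.θ z.2 / r.b := by field_simp; ring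
    simp only [tilt, null, zero_div, add_zero, sub_zero]
    rw [h3, h4, ← ENNReal.ofReal_pow (by linarith), ← ENNReal.ofReal_pow (by linarith),
      ← ENNReal.ofReal_mul (by norm_num), ← ENNReal.ofReal_mul (by norm_num),
      ← ENNReal.ofReal_add (by positivity) (by positivity), ← ENNReal.ofReal_one,
      ← ENNReal.ofReal_add (by norm_num) (by positivity)]
    congr 1
    field_simp
    ring
  simp_rw [h1]
  have hbd : Integrable (fun a => r.θ a ^ 2 / r.b ^ 2) μ := by
    refine Integrable.of_bound (by fun_prop) 1 (Filter.Eventually.of_forall fun a => ?_)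
    rw [← div_pow, Real.norm_eq_abs, abs_of_nonneg (by positivity), sq_le_one_iff_abs_le_one,
      abs_le]
    exact ⟨r.neg_one_le a, r.le_one a⟩
  rw [lintegral_add_left measurable_const, ← integral_div,
    ofReal_integral_eq_lintegral_ofReal hbd (Filter.Eventually.of_forall fun a => by positivity)]
  congr 1
  · simp
  · rw [lintegral_prod _ (by fun_prop)]
    simp

/-! ### Conditional laws -/

theorem xaLaw_target : xaLaw (r.target ν μ) = ν.prod μ := by
  rw [xaLaw, target, Measure.map_map (by fun_prop) (by fun_prop)]
  exact Measure.fst_compProd (ν.prod μ) (r.kernel X)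

theorem xLaw_target : xLaw (r.target ν μ) = ν := by
  have h : xLaw (r.target ν μ) = (xaLaw (r.target ν μ)).map Prod.fst := by
    rw [xaLaw, Measure.map_map (by fun_prop) (by fun_prop)]
    rfl
  rw [h, xaLaw_target]
  exact Measure.fst_prod

theorem aGivenX_target : aGivenX (r.target ν μ) =ᵐ[ν] Kernel.const X μ := by
  have h := condDistrib_ae_eq_of_measure_eq_compProd (μ := r.target ν μ) (fun z => z.1)
    (Y := fun z : Unit3 X d => z.2.1) (κ := Kernel.const X μ) (by fun_prop) (by
      rw [Measure.compProd_const]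
      change xaLaw (r.target ν μ) = (xLaw (r.target ν μ)).prod μ
      rw [xaLaw_target, xLaw_target])
  change _ =ᵐ[xLaw (r.target ν μ)] _ at h
  rwa [xLaw_target] at h

theorem yGivenXA_target : yGivenXA (r.target ν μ) =ᵐ[ν.prod μ] r.kernel X := by
  have h := condDistrib_ae_eq_of_measure_eq_compProd (μ := r.target ν μ) (fun z => (z.1, z.2.1))
    (Y := fun z : Unit3 X d => z.2.2) (κ := r.kernel X) (by fun_prop) (by
      change _ = xaLaw (r.target ν μ) ⊗ₘ r.kernel X
      rw [xaLaw_target, map_target_fst_pair])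
  change _ =ᵐ[xaLaw (r.target ν μ)] _ at h
  rwa [xaLaw_target] at h

theorem outcomeMean_target :
    ∀ᵐ z ∂(ν.prod μ), outcomeMean (r.target ν μ) z.1 z.2 = r.θ z.2 := by
  filter_upwards [r.yGivenXA_target ν μ] with z hz
  rw [outcomeMean, hz, r.integral_kernel_id]

/-- The outcome mean is known only for almost every pair `(x, a)`; Fubini with the coordinates
swapped fixes almost every `a` before integrating over `x`. -/
theorem cdrf_target : cdrf (r.target ν μ) =ᵐ[μ] r.θ := by
  have h := (Measure.measurePreserving_swap (μ := μ) (ν := ν)).quasiMeasurePreserving.ae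
    (r.outcomeMean_target ν μ)
  filter_upwards [Measure.ae_ae_of_ae_prod h] with a ha
  have ha' : (fun x => outcomeMean (r.target ν μ) x a) =ᵐ[ν] fun _ => r.θ a := ha
  rw [cdrf, xLaw_target, integral_congr_ae ha']
  simp

/-- Centred outcomes are bounded by `2 b`, so the `m`-th moment is at most `(2 b)² (2 b) ^ (m - 2)`,
and `m! / 2 ≥ 1`. Independence of `X` and `A ∼ μ` makes the density ratio one. -/
theorem momentConditions_target {sd L cμ : ℝ} (hsd : 2 * r.b ≤ sd) (hL : 2 * r.b ≤ L)
    (hcμ : 1 ≤ cμ) (hθ : ∀ a, |r.θ a| ≤ 1) :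
    MomentConditions μ sd L cμ (r.target ν μ) where
  bounded_mean := by
    rw [xLaw_target]
    filter_upwards [r.outcomeMean_target ν μ] with z hz
    rw [hz]
    exact hθ _
  subexponential := by
    rw [xaLaw_target]
    have hb := r.b_pos
    have h := (Measure.quasiMeasurePreserving_snd (μ := ν) (ν := μ)).ae (r.cdrf_target ν μ)
    filter_upwards [h, r.yGivenXA_target ν μ] with z hz hy m hm
    rw [hz, hy]
    have h1 : ∀ᵐ y ∂(r.kernel X z), ENNReal.ofReal (|y - r.θ z.2| ^ m) ≤
        ENNReal.ofReal (1 / 2 * (m.factorial : ℝ) * sd ^ 2 * L ^ (m - 2)) := by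
      filter_upwards [r.ae_kernel_abs_le z] with y hy
      refine ENNReal.ofReal_le_ofReal ?_
      have h2 : |y - r.θ z.2| ≤ 2 * r.b := by
        refine (abs_sub _ _).trans ?_
        linarith [r.bound z.2]
      have h3 : (1 : ℝ) ≤ 1 / 2 * (m.factorial : ℝ) := by
        have : (2 : ℝ) ≤ m.factorial := by
          exact_mod_cast (Nat.factorial_le hm : Nat.factorial 2 ≤ _)
        linarith
      calc |y - r.θ z.2| ^ m ≤ (2 * r.b) ^ m := by gcongr
        _ = 1 * (2 * r.b) ^ 2 * (2 * r.b) ^ (m - 2) := by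
            rw [one_mul, ← pow_add, Nat.add_sub_cancel' hm]
        _ ≤ _ := by gcongr
    refine (lintegral_mono_ae h1).trans ?_
    simp
  density_ratio := by
    rw [xLaw_target]
    filter_upwards [r.aGivenX_target ν μ] with x hx
    rw [hx, Kernel.const_apply]
    refine ⟨Measure.AbsolutelyContinuous.refl _, ?_⟩
    filter_upwards [μ.rnDeriv_self] with a ha
    rw [ha, ENNReal.ofReal_le_one, ENNReal.one_le_ofReal]
    exact ⟨inv_le_one_of_one_le₀ hcμ, hcμ⟩

variable {μ} in
theorem integrable_residual {g : Dose d → ℝ} (hg : Integrable g μ) :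
    Integrable (fun z => g z.2.1 * (r.θ z.2.1 - z.2.2)) (r.target ν μ) := by
  have hr := r.measurable
  have hpa : MeasurePreserving (fun z : Unit3 X d => z.2.1) (r.target ν μ) μ := by
    refine ⟨by fun_prop, ?_⟩
    have : (r.target ν μ).map (fun z => z.2.1) = (xaLaw (r.target ν μ)).map Prod.snd := by
      rw [xaLaw, Measure.map_map (by fun_prop) (by fun_prop)]
      rfl
    rw [this, xaLaw_target]
    exact Measure.snd_prod
  have hg' : Integrable (fun z : Unit3 X d => g z.2.1) (r.target ν μ) :=
    hpa.integrable_comp_of_integrable hg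
  refine hg'.mul_bdd (c := 2 * r.b) (by fun_prop) ?_
  filter_upwards [r.ae_target_abs_le ν μ] with z hz
  rw [Real.norm_eq_abs]
  refine (abs_sub _ _).trans ?_
  linarith [r.bound z.2.1]

variable {μ} in
-- Given `(X, A)` the residual `θ A - Y` has mean zero, whatever weight `g A` multiplies it.
theorem integral_residual {g : Dose d → ℝ} (hg : Integrable g μ) :
    ∫ z, g z.2.1 * (r.θ z.2.1 - z.2.2) ∂(r.target ν μ) = 0 := by
  have hi := r.integrable_residual ν hg
  have hm : Measurable fun z : (X × Dose d) × ℝ => ((z.1.1, z.1.2, z.2) : Unit3 X d) := by fun_prop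
  rw [target] at hi ⊢
  have hi' := hi.comp_measurable hm
  rw [integral_map hm.aemeasurable hi.1]
  change ∫ x, ((fun z : Unit3 X d => g z.2.1 * (r.θ z.2.1 - z.2.2)) ∘
    fun z : (X × Dose d) × ℝ => (z.1.1, z.1.2, z.2)) x ∂_ = 0
  rw [Measure.integral_compProd hi']
  refine integral_eq_zero_of_ae (Filter.Eventually.of_forall fun z => ?_)
  simp only [Pi.zero_apply]
  change ∫ y, g z.2 * (r.θ z.2 - y) ∂(r.kernel X z) = 0
  rw [r.integral_kernel z fun y => g z.2 * (r.θ z.2 - y)]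
  field_simp [r.b_pos.ne']
  ring

end BinaryResponse

end Binary

/-! ### The law of the source label -/

section Sources

variable {k : ℕ}

/-- The probability measure on the sources with weights `q`. -/
noncomputable def sourceLaw (q : Fin k → ℝ) : Measure (Fin k) :=
  ∑ s, ENNReal.ofReal (q s) • Measure.dirac s

theorem sourceLaw_coe {q : Fin k → ℝ} (hq : ∀ s, 0 ≤ q s) (T : Finset (Fin k)) :
    sourceLaw q (T : Set (Fin k)) = ENNReal.ofReal (∑ s ∈ T, q s) := by
  rw [sourceLaw, Measure.finsetSum_apply, ENNReal.ofReal_sum_of_nonneg fun s _ => hq s]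
  simp only [Measure.smul_apply, Measure.dirac_apply, smul_eq_mul, Set.indicator_apply,
    Finset.mem_coe, Pi.one_apply, mul_ite, mul_one, mul_zero]
  simp

theorem isProbabilityMeasure_sourceLaw {q : Fin k → ℝ} (hq : ∀ s, 0 ≤ q s) (hq1 : ∑ s, q s = 1) :
    IsProbabilityMeasure (sourceLaw q) := by
  constructor
  rw [← Finset.coe_univ, sourceLaw_coe hq, hq1, ENNReal.ofReal_one]

end Sources

/-! ### Observations whose source is independent of the data -/

section ObservationLaw

variable {X : Type*} [MeasurableSpace X] {d k : ℕ}

/-- The law of `(X, A, Y, S)` with `(X, A, Y) ∼ Q` and `S ∼ ρ` independent. -/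
noncomputable def obsLaw (Q : Measure (Unit3 X d)) (ρ : Measure (Fin k)) : Measure (Obs X d k) :=
  (Q.prod ρ).map fun z => (z.1.1, z.1.2.1, z.1.2.2, z.2)

theorem obsLaw_map_fst (Q : Measure (Unit3 X d)) [SFinite Q] (ρ : Measure (Fin k))
    [IsProbabilityMeasure ρ] :
    (obsLaw Q ρ).map (fun z => ((z.1, z.2.1, z.2.2.1) : Unit3 X d)) = Q := by
  rw [obsLaw, Measure.map_map (by fun_prop) (by fun_prop)]
  exact Measure.fst_prod

instance (Q : Measure (Unit3 X d)) [IsFiniteMeasure Q] : IsMarkovKernel (aGivenX Q) := by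
  unfold aGivenX
  infer_instance

theorem obsLaw_inter (Q : Measure (Unit3 X d)) (ρ : Measure (Fin k)) [SFinite ρ]
    {B : Set (Unit3 X d)} (hB : MeasurableSet B) (T : Set (Fin k)) :
    obsLaw Q ρ ({z | z.2.2.2 ∈ T} ∩ {z | (z.1, z.2.1, z.2.2.1) ∈ B}) = ρ T * Q B := by
  have h1 : Measurable fun z : Obs X d k => z.2.2.2 := by fun_prop
  have h2 : Measurable fun z : Obs X d k => ((z.1, z.2.1, z.2.2.1) : Unit3 X d) := by fun_prop
  have h3 : MeasurableSet
      ({z : Obs X d k | z.2.2.2 ∈ T} ∩ {z | (z.1, z.2.1, z.2.2.1) ∈ B}) :=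
    (h1 (MeasurableSet.of_discrete (s := T))).inter (h2 hB)
  rw [obsLaw, Measure.map_apply (by fun_prop) h3, mul_comm, ← Measure.prod_prod]
  congr 1
  ext z
  simp [and_comm]

variable (Q : Measure (Unit3 X d)) [IsProbabilityMeasure Q] (ρ : Measure (Fin k))
  [IsProbabilityMeasure ρ]

instance : IsProbabilityMeasure (obsLaw Q ρ) :=
  Measure.isProbabilityMeasure_map (by fun_prop)

theorem measurableSet_sourceIn (T : Finset (Fin k)) : MeasurableSet (sourceIn X d T) := by
  have h : Measurable fun z : Obs X d k => z.2.2.2 := by fun_prop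
  exact h (MeasurableSet.of_discrete (s := (T : Set (Fin k))))

theorem obsLaw_sourceIn (Q : Measure (Unit3 X d)) [IsProbabilityMeasure Q] (ρ : Measure (Fin k))
    [SFinite ρ] (T : Finset (Fin k)) : obsLaw Q ρ (sourceIn X d T) = ρ T := by
  have h := obsLaw_inter Q ρ MeasurableSet.univ (T : Set (Fin k))
  simpa [sourceIn] using h

/-- Conditioning on an event about the independent label leaves the law of `(X, A, Y)` unchanged. -/
theorem lawGiven_obsLaw {T : Finset (Fin k)} (hT : ρ T ≠ 0) : lawGiven (obsLaw Q ρ) T = Q := by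
  ext B hB
  have h2 : Measurable fun z : Obs X d k => ((z.1, z.2.1, z.2.2.1) : Unit3 X d) := by fun_prop
  rw [lawGiven, Measure.map_apply h2 hB, cond_apply (measurableSet_sourceIn T), obsLaw_sourceIn]
  have h := obsLaw_inter Q ρ hB (T : Set (Fin k))
  change _ * obsLaw Q ρ ({z | z.2.2.2 ∈ (T : Set (Fin k))} ∩ {z | (z.1, z.2.1, z.2.2.1) ∈ B}) = _
  rw [h, ← mul_assoc, ENNReal.inv_mul_cancel hT (measure_ne_top _ _), one_mul]

theorem yGivenXA_congr {Q Q' : Measure (Unit3 X d)} [IsFiniteMeasure Q] [IsFiniteMeasure Q']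
    (h : Q = Q') : yGivenXA Q = yGivenXA Q' := by
  subst h
  rfl

theorem aGivenX_congr {Q Q' : Measure (Unit3 X d)} [IsFiniteMeasure Q] [IsFiniteMeasure Q']
    (h : Q = Q') : aGivenX Q = aGivenX Q' := by
  subst h
  rfl

theorem outcomeMean_congr {Q Q' : Measure (Unit3 X d)} [IsFiniteMeasure Q] [IsFiniteMeasure Q']
    (h : Q = Q') : outcomeMean Q = outcomeMean Q' := by
  subst h
  rfl

/-- Every source of positive probability carries the law `Q` itself, so the alignment is exact and
all density ratios are one. -/
theorem fusionConditions_obsLaw {SX SY : Finset (Fin k)} {Mξ Mη c₁ : ℝ} (hMη : 1 ≤ Mη)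
    (hc₁ : 1 ≤ c₁) (hSX : Mξ⁻¹ ≤ ρ.real SX) (hSY : Mη⁻¹ ≤ ρ.real SY) :
    FusionConditions SX SY Mξ Mη c₁ (obsLaw Q ρ) Q where
  prob_SX := by rwa [measureReal_def, obsLaw_sourceIn]
  prob_SY := by rwa [measureReal_def, obsLaw_sourceIn]
  overlap_ac s _ hs := by
    rw [obsLaw_sourceIn] at hs
    rw [lawGiven_obsLaw Q ρ hs]
  overlap_ratio := by
    have hS : ρ SY ≠ 0 := by
      intro h
      rw [measureReal_def, h, ENNReal.toReal_zero] at hSY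
      exact absurd hSY (not_le.mpr (by positivity))
    have : IsProbabilityMeasure (xaLaw Q) := Measure.isProbabilityMeasure_map (by fun_prop)
    rw [lawGiven_obsLaw Q ρ hS]
    filter_upwards [(xaLaw Q).rnDeriv_self] with a ha
    rw [ha, ENNReal.ofReal_le_one, ENNReal.one_le_ofReal]
    exact ⟨inv_le_one_of_one_le₀ hc₁, hc₁⟩
  align_X s _ hs := by
    rw [obsLaw_sourceIn] at hs
    rw [lawGiven_obsLaw Q ρ hs]
  align_Y s _ hs := by
    rw [obsLaw_sourceIn] at hs
    rw [yGivenXA_congr (lawGiven_obsLaw Q ρ hs)]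
    exact Filter.Eventually.of_forall fun _ => rfl

/-- Keep `(x, a, y)` if the source is in `T`, erase the observation otherwise. -/
noncomputable def keepObs (T : Finset (Fin k)) (z : Obs X d k) : Unit3 X d ⊕ Unit :=
  if z.2.2.2 ∈ T then Sum.inl (z.1, z.2.1, z.2.2.1) else Sum.inr ()

theorem measurable_keepObs (T : Finset (Fin k)) : Measurable (keepObs (X := X) (d := d) T) := by
  refine Measurable.ite (measurableSet_sourceIn T) ?_ measurable_const
  exact measurable_inl.comp (by fun_prop)

theorem map_keepObs_obsLaw (Q : Measure (Unit3 X d)) [IsProbabilityMeasure Q] (ρ : Measure (Fin k))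
    [SFinite ρ] (T : Finset (Fin k)) :
    (obsLaw Q ρ).map (keepObs T) =
      ρ T • Q.map Sum.inl + ρ (T : Set (Fin k))ᶜ • Measure.dirac (Sum.inr ()) := by
  classical
  ext B hB
  have hB1 : MeasurableSet ((Sum.inl : Unit3 X d → Unit3 X d ⊕ Unit) ⁻¹' B) := measurable_inl hB
  rw [Measure.map_apply (measurable_keepObs T) hB, Measure.add_apply, Measure.smul_apply,
    Measure.smul_apply, Measure.map_apply measurable_inl hB, Measure.dirac_apply' _ hB,
    smul_eq_mul, smul_eq_mul, ← measure_inter_add_sdiff (keepObs T ⁻¹' B)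
      (measurableSet_sourceIn T)]
  congr 1
  · rw [← obsLaw_inter Q ρ hB1]
    congr 1
    ext z
    simp only [Set.mem_inter_iff, Set.mem_preimage, sourceIn, keepObs, Set.mem_ofPred_eq,
      Finset.mem_coe]
    constructor
    · rintro ⟨h1, h2⟩
      rw [if_pos h2] at h1
      exact ⟨h2, h1⟩
    · rintro ⟨h1, h2⟩
      rw [if_pos h1]
      exact ⟨h2, h1⟩
  · have hC : MeasurableSet {_z : Unit3 X d | (Sum.inr () : Unit3 X d ⊕ Unit) ∈ B} :=
      MeasurableSet.const _
    have h3 : Q {_z : Unit3 X d | (Sum.inr () : Unit3 X d ⊕ Unit) ∈ B} =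
        B.indicator 1 (Sum.inr ()) := by
      by_cases h : (Sum.inr () : Unit3 X d ⊕ Unit) ∈ B <;> simp [h]
    rw [← h3, ← obsLaw_inter Q ρ hC]
    congr 1
    ext z
    simp only [Set.mem_sdiff, Set.mem_inter_iff, Set.mem_preimage, sourceIn, keepObs,
      Set.mem_ofPred_eq, Set.mem_compl_iff, Finset.mem_coe]
    constructor
    · rintro ⟨h1, h2⟩
      rw [if_neg h2] at h1
      exact ⟨h2, h1⟩
    · rintro ⟨h1, h2⟩
      rw [if_neg h1]
      exact ⟨h2, h1⟩

variable {μ : Measure (Dose d)} [IsProbabilityMeasure μ] (ν : Measure X) [IsProbabilityMeasure ν]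
  (r : BinaryResponse d)

/-- The density of one aligned observation with respect to vanishing regression. -/
noncomputable def keptTilt (z : Unit3 X d ⊕ Unit) : ℝ≥0∞ := Sum.elim r.tilt (fun _ => 1) z

theorem measurable_keptTilt : Measurable (keptTilt (X := X) r) :=
  Measurable.sumElim r.measurable_tilt measurable_const

/-- The atom of erased observations has the same mass for every regression, so the likelihood ratio
is one there and equals `tilt` on the kept part. -/
theorem map_keepObs_eq_withDensity (ρ : Measure (Fin k)) [SFinite ρ]
    (ν : Measure X) [IsProbabilityMeasure ν] (r : BinaryResponse d) (T : Finset (Fin k)) :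
    (obsLaw (r.target ν μ) ρ).map (keepObs T) =
      ((obsLaw (r.null.target ν μ) ρ).map (keepObs T)).withDensity (keptTilt r) := by
  have h1 : (Measure.map (Sum.inl : Unit3 X d → Unit3 X d ⊕ Unit) (r.target ν μ)) =
      (Measure.map Sum.inl (r.null.target ν μ)).withDensity (keptTilt r) := by
    rw [r.target_eq_withDensity]
    ext B hB
    rw [Measure.map_apply measurable_inl hB, withDensity_apply _ (measurable_inl hB),
      withDensity_apply _ hB, setLIntegral_map hB (measurable_keptTilt r) measurable_inl]
    rfl
  have h2 : (Measure.dirac (Sum.inr () : Unit3 X d ⊕ Unit)).withDensity (keptTilt r) =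
      Measure.dirac (Sum.inr ()) := by
    have h : keptTilt r =ᵐ[Measure.dirac (Sum.inr () : Unit3 X d ⊕ Unit)] 1 := by
      rw [Filter.EventuallyEq, ae_dirac_iff]
      · rfl
      · exact measurable_keptTilt r (measurableSet_singleton 1)
    rw [withDensity_congr_ae h, withDensity_one]
  rw [map_keepObs_obsLaw, map_keepObs_obsLaw, withDensity_add_measure, withDensity_smul_measure,
    withDensity_smul_measure, ← h1, h2]

/-- Only the kept fraction contributes to the chi-square divergence. The factor `ρ.real T` is what
replaces `n` by `n_XY` in the rate. -/
theorem lintegral_keptTilt_sq (T : Finset (Fin k)) :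
    ∫⁻ z, keptTilt r z ^ 2 ∂((obsLaw (r.null.target ν μ) ρ).map (keepObs T)) =
      1 + ENNReal.ofReal (ρ.real T * ((∫ a, r.θ a ^ 2 ∂μ) / r.b ^ 2)) := by
  have hm := (measurable_keptTilt (X := X) r).pow_const 2
  rw [map_keepObs_obsLaw, lintegral_add_measure, lintegral_smul_measure, lintegral_smul_measure,
    lintegral_map hm measurable_inl, lintegral_dirac' _ hm]
  change ρ T * ∫⁻ z, r.tilt z ^ 2 ∂(r.null.target ν μ) + ρ (T : Set (Fin k))ᶜ * 1 ^ 2 = _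
  rw [r.lintegral_tilt_sq, ENNReal.ofReal_mul measureReal_nonneg, measureReal_def,
    ENNReal.ofReal_toReal (measure_ne_top _ _), mul_add, one_pow, mul_one, mul_one, add_right_comm,
    prob_add_prob_compl (MeasurableSet.of_discrete)]

/-! ### Risk -/

/-- The true regression does not depend on `x`, so the cross term with `θ₀ - m₀` vanishes almost
everywhere; the weight is one and the residual term integrates to zero. -/
theorem risk_obsLaw {SX SY : Finset (Fin k)} (hSX : ρ SX ≠ 0) (hSY : ρ SY ≠ 0)
    {θ : Dose d → ℝ} (hθ : MemLp θ 2 μ) :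
    risk μ SX SY (obsLaw (r.target ν μ) ρ) θ (trueNuisance μ SX SY (obsLaw (r.target ν μ) ρ)) =
      ∫ a, (θ a - r.θ a) ^ 2 ∂μ := by
  set Q := r.target ν μ with hQ
  set P := obsLaw Q ρ with hP
  set g := trueNuisance μ SX SY P with hg
  have hr := r.measurable
  have hX := lawGiven_obsLaw Q ρ hSX
  have hY := lawGiven_obsLaw Q ρ hSY
  have hgm : g.m = outcomeMean Q := outcomeMean_congr hY
  have hgτ : g.τ =ᵐ[μ] r.θ := by
    have : g.τ = cdrf Q := by
      ext a
      change ∫ x, outcomeMean (lawGiven P SY) x a ∂(xLaw (lawGiven P SX)) = _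
      rw [outcomeMean_congr hY, hX, cdrf]
    rw [this]
    exact r.cdrf_target ν μ
  have hgm' : ∀ᵐ z ∂(ν.prod μ), g.m z.1 z.2 = r.θ z.2 := by
    rw [hgm]
    exact r.outcomeMean_target ν μ
  have hgw : ∀ᵐ z ∂(ν.prod μ), g.w z.1 z.2 = 1 := by
    have hw : ∀ x a, g.w x a = (ν.rnDeriv ν x).toReal *
        (1 / (Kernel.rnDeriv (aGivenX Q) (Kernel.const X μ) x a).toReal) := by
      intro x a
      change ((xLaw (lawGiven P SX)).rnDeriv (xLaw (lawGiven P SY)) x).toReal *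
        (1 / (Kernel.rnDeriv (aGivenX (lawGiven P SY)) (Kernel.const X μ) x a).toReal) = _
      rw [aGivenX_congr hY, hX, hY, r.xLaw_target]
    have hmeas : MeasurableSet {z : X × Dose d | (ν.rnDeriv ν z.1).toReal *
        (1 / (Kernel.rnDeriv (aGivenX Q) (Kernel.const X μ) z.1 z.2).toReal) = 1} := by
      refine measurableSet_eq_fun ?_ measurable_const
      have h1 : Measurable fun z : X × Dose d =>
          Kernel.rnDeriv (aGivenX Q) (Kernel.const X μ) z.1 z.2 :=
        Kernel.measurable_rnDeriv _ _
      have h2 : Measurable fun z : X × Dose d => ν.rnDeriv ν z.1 :=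
        (Measure.measurable_rnDeriv ν ν).comp measurable_fst
      fun_prop
    simp_rw [hw]
    refine (Measure.ae_prod_iff_ae_ae hmeas).mpr ?_
    filter_upwards [r.aGivenX_target ν μ, ν.rnDeriv_self] with x hx hx'
    have h3 := Kernel.rnDeriv_eq_rnDeriv_measure (κ := aGivenX Q) (η := Kernel.const X μ) (a := x)
    rw [hx, Kernel.const_apply] at h3
    filter_upwards [h3, μ.rnDeriv_self] with a h3 h4
    rw [hx', h3, h4]
    simp
  have hPQ : MeasurePreserving (fun z : Obs X d k => ((z.1, z.2.1, z.2.2.1) : Unit3 X d)) P Q :=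
    ⟨by fun_prop, obsLaw_map_fst Q ρ⟩
  have hQXA : MeasurePreserving (fun z : Unit3 X d => (z.1, z.2.1)) Q (ν.prod μ) :=
    ⟨by fun_prop, r.xaLaw_target ν μ⟩
  have hPX : MeasurePreserving (fun z : Obs X d k => z.1) P ν :=
    (measurePreserving_fst (μ := ν) (ν := μ)).comp (hQXA.comp hPQ)
  have hxa : MeasurePreserving (fun z : Obs X d k × Dose d => (z.1.1, z.1.2.1)) (P.prod μ)
      (ν.prod μ) := (hQXA.comp hPQ).comp measurePreserving_fst
  have hxb : MeasurePreserving (fun z : Obs X d k × Dose d => (z.1.1, z.2)) (P.prod μ)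
      (ν.prod μ) := hPX.prod (MeasurePreserving.id μ)
  have hb : MeasurePreserving (fun z : Obs X d k × Dose d => z.2) (P.prod μ) μ :=
    measurePreserving_snd
  have ha : MeasurePreserving (fun z : Obs X d k × Dose d => z.1.2.1) (P.prod μ) μ :=
    measurePreserving_snd.comp hxa
  have hloss : loss SX SY θ g =ᵐ[P.prod μ] fun z => (θ z.2 - r.θ z.2) ^ 2 +
      2 * g.η * ((θ z.1.2.1 - r.θ z.1.2.1) * (r.θ z.1.2.1 - z.1.2.2.1) *
        (if z.1.2.2.2 ∈ SY then 1 else 0)) := by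
    filter_upwards [hxa.quasiMeasurePreserving.ae hgm', hxa.quasiMeasurePreserving.ae hgw,
      hxb.quasiMeasurePreserving.ae hgm', hb.quasiMeasurePreserving.ae hgτ,
      ha.quasiMeasurePreserving.ae hgτ] with z h1 h2 h3 h4 h5
    simp only [loss, h1, h2, h3, h4, h5]
    ring
  have hrL : MemLp r.θ 2 μ := MemLp.of_bound hr.aestronglyMeasurable r.b
    (Filter.Eventually.of_forall fun a => r.bound a)
  have hdiff : MemLp (fun a => θ a - r.θ a) 2 μ := hθ.sub hrL
  have hint1 : Integrable (fun z : Obs X d k × Dose d => (θ z.2 - r.θ z.2) ^ 2) (P.prod μ) :=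
    hb.integrable_comp_of_integrable (g := fun a => (θ a - r.θ a) ^ 2) hdiff.integrable_sq
  have hdi : Integrable (fun a => θ a - r.θ a) μ := hdiff.integrable one_le_two
  have hres : Integrable (fun z : Unit3 X d × Fin k =>
      (θ z.1.2.1 - r.θ z.1.2.1) * (r.θ z.1.2.1 - z.1.2.2) *
        (if z.2 ∈ SY then (1 : ℝ) else 0)) (Q.prod ρ) :=
    (r.integrable_residual ν hdi).mul_prod 
      (Integrable.of_finite (f := fun s => if s ∈ SY then (1 : ℝ) else 0))
  have hres0 : ∫ z : Unit3 X d × Fin k, (θ z.1.2.1 - r.θ z.1.2.1) * (r.θ z.1.2.1 - z.1.2.2) *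
        (if z.2 ∈ SY then (1 : ℝ) else 0) ∂(Q.prod ρ) = 0 := by
    rw [integral_prod_mul (fun z : Unit3 X d => (θ z.2.1 - r.θ z.2.1) * (r.θ z.2.1 - z.2.2))
      (fun s => if s ∈ SY then (1 : ℝ) else 0), hQ,
      r.integral_residual ν (g := fun a => θ a - r.θ a) hdi, zero_mul]
  have hPmap : MeasurePreserving (fun z : Obs X d k => ((z.1, z.2.1, z.2.2.1), z.2.2.2)) P
      (Q.prod ρ) := by
    refine ⟨by fun_prop, ?_⟩
    rw [hP, obsLaw, Measure.map_map (by fun_prop) (by fun_prop)]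
    exact Measure.map_id
  -- Separating the label from `(X, A, Y)` gives a product law, under which the residual integral
  -- factorizes.
  have hPm2 := hPmap.comp (measurePreserving_fst (μ := P) (ν := μ))
  have hint2 : Integrable (fun z : Obs X d k × Dose d => (θ z.1.2.1 - r.θ z.1.2.1) *
      (r.θ z.1.2.1 - z.1.2.2.1) * (if z.1.2.2.2 ∈ SY then (1 : ℝ) else 0)) (P.prod μ) :=
    hPm2.integrable_comp_of_integrable hres
  have hint2_zero : ∫ z : Obs X d k × Dose d, (θ z.1.2.1 - r.θ z.1.2.1) *
      (r.θ z.1.2.1 - z.1.2.2.1) * (if z.1.2.2.2 ∈ SY then (1 : ℝ) else 0) ∂(P.prod μ) = 0 := by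
    refine Eq.trans ?_ hres0
    rw [← hPm2.map_eq, integral_map hPm2.measurable.aemeasurable]
    · rfl
    · rw [hPm2.map_eq]
      exact hres.1
  have hint1_eq : ∫ z : Obs X d k × Dose d, (θ z.2 - r.θ z.2) ^ 2 ∂(P.prod μ) =
      ∫ a, (θ a - r.θ a) ^ 2 ∂μ := by
    conv_rhs => rw [← hb.map_eq]
    rw [integral_map hb.measurable.aemeasurable]
    rw [hb.map_eq]
    exact hdiff.integrable_sq.1
  rw [risk, integral_congr_ae hloss, integral_add hint1 (Integrable.const_mul hint2 _), hint1_eq,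
    integral_const_mul, hint2_zero, mul_zero, add_zero]

end ObservationLaw

/-! ### The cube of sign vectors and its separation -/

section Hypercube

variable {d : ℕ} {μ : Measure (Dose d)} {ef : ℕ → Lp ℝ 2 μ}

/-- The coefficient `± ε` that the sign vector `v` puts on the eigenfunction number `j`. -/
def signCoeff (ε : ℝ) {m : ℕ} (v : Fin m → Bool) (j : ℕ) : ℝ :=
  if h : j < m then (if v ⟨j, h⟩ then ε else -ε) else 0

theorem abs_signCoeff_le {ε : ℝ} (hε : 0 ≤ ε) {m : ℕ} (v : Fin m → Bool) (j : ℕ) :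
    |signCoeff ε v j| ≤ ε := by
  unfold signCoeff
  split_ifs <;> simp [abs_of_nonneg hε, hε]

theorem signCoeff_sq (ε : ℝ) {m : ℕ} (v : Fin m → Bool) {j : ℕ} (hj : j < m) :
    signCoeff ε v j ^ 2 = ε ^ 2 := by
  unfold signCoeff
  split_ifs <;> simp

theorem sum_signCoeff_sub_sq (ε : ℝ) {m : ℕ} (v w : Fin m → Bool) :
    ∑ j ∈ Finset.range m, (signCoeff ε v j - signCoeff ε w j) ^ 2 =
      4 * ε ^ 2 * hammingDist v w := by
  rw [Finset.sum_range]
  have h : ∀ i : Fin m, (signCoeff ε v i - signCoeff ε w i) ^ 2 =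
      4 * ε ^ 2 * (if v i ≠ w i then 1 else 0) := by
    intro i
    simp only [signCoeff, i.isLt, dif_pos, Fin.eta]
    cases v i <;> cases w i <;> simp <;> ring
  simp_rw [h]
  rw [← Finset.mul_sum, Finset.sum_boole, hammingDist]

/-- A representative of `f` that is bounded by `M`, if `f` is essentially bounded by `M`. -/
noncomputable def clip (M : ℝ) (f : Lp ℝ 2 μ) (a : Dose d) : ℝ := if |f a| ≤ M then f a else 0

theorem measurable_clip (M : ℝ) (f : Lp ℝ 2 μ) : Measurable (clip M f) := by
  have hf : Measurable f := (Lp.stronglyMeasurable f).measurable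
  exact Measurable.ite (measurableSet_le hf.abs measurable_const) hf measurable_const

theorem abs_clip_le {M : ℝ} (hM : 0 ≤ M) (f : Lp ℝ 2 μ) (a : Dose d) : |clip M f a| ≤ M := by
  unfold clip
  split_ifs with h
  · exact h
  · simpa using hM

theorem clip_ae_eq {M : ℝ} {f : Lp ℝ 2 μ} (hf : ∀ᵐ a ∂μ, |f a| ≤ M) : clip M f =ᵐ[μ] f := by
  filter_upwards [hf] with a ha
  exact if_pos ha

/-- The regression function `∑ j < m, ± ε * ef j` with signs `v`. -/
noncomputable def signResponse (ef : ℕ → Lp ℝ 2 μ) {M b ε : ℝ} (hM : 0 ≤ M) (hb : 0 < b)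
    (hε : 0 ≤ ε) {m : ℕ} (h : ε * m * M ≤ b) (v : Fin m → Bool) : BinaryResponse d where
  b := b
  -- Clipping changes the eigenfunctions on a null set only and makes the bound hold at every `a`,
  -- so that `(1 ± θ / b) / 2` are probabilities everywhere.
  θ a := ∑ j ∈ Finset.range m, signCoeff ε v j * clip M (ef j) a
  b_pos := hb
  measurable := Finset.measurable_sum _ fun j _ => (measurable_clip M (ef j)).const_mul _
  bound a := by
    calc _ ≤ ∑ j ∈ Finset.range m, |signCoeff ε v j * clip M (ef j) a| :=
          Finset.abs_sum_le_sum_abs _ _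
      _ ≤ ∑ _j ∈ Finset.range m, ε * M := by
          refine Finset.sum_le_sum fun j _ => ?_
          rw [abs_mul]
          exact mul_le_mul (abs_signCoeff_le hε v j) (abs_clip_le hM _ _) (abs_nonneg _) hε
      _ = ε * m * M := by
          rw [Finset.sum_const, Finset.card_range, nsmul_eq_mul]
          ring
      _ ≤ b := h

variable {M b ε : ℝ} (hM : 0 ≤ M) (hb : 0 < b) (hε : 0 ≤ ε) {m : ℕ} (h : ε * m * M ≤ b)

theorem signResponse_ae_eq (hbdd : ∀ j, ∀ᵐ a ∂μ, |ef j a| ≤ M) (v : Fin m → Bool) :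
    (signResponse ef hM hb hε h v).θ =ᵐ[μ]
      fun a => ∑ j ∈ Finset.range m, signCoeff ε v j * ef j a := by
  filter_upwards [ae_all_iff.mpr fun j => clip_ae_eq (hbdd j)] with a ha
  simp only [signResponse, ha]

theorem integral_signResponse_sq (hbdd : ∀ j, ∀ᵐ a ∂μ, |ef j a| ≤ M) (hef : Orthonormal ℝ ef)
    (v : Fin m → Bool) : ∫ a, (signResponse ef hM hb hε h v).θ a ^ 2 ∂μ = ε ^ 2 * m := by
  rw [integral_sq_sum hef m _ (signResponse_ae_eq hM hb hε h hbdd v)]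
  rw [Finset.sum_congr rfl fun j hj => signCoeff_sq ε v (Finset.mem_range.mp hj)]
  simp [mul_comm]

theorem integral_signResponse_sub_sq (hbdd : ∀ j, ∀ᵐ a ∂μ, |ef j a| ≤ M)
    (hef : Orthonormal ℝ ef) (v w : Fin m → Bool) :
    ∫ a, ((signResponse ef hM hb hε h v).θ a - (signResponse ef hM hb hε h w).θ a) ^ 2 ∂μ =
      4 * ε ^ 2 * hammingDist v w := by
  rw [integral_sq_sum hef m (fun j => signCoeff ε v j - signCoeff ε w j)
    (θ := fun a => (signResponse ef hM hb hε h v).θ a - (signResponse ef hM hb hε h w).θ a),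
    sum_signCoeff_sub_sq]
  filter_upwards [signResponse_ae_eq hM hb hε h hbdd v, signResponse_ae_eq hM hb hε h hbdd w]
    with a h1 h2
  rw [h1, h2, ← Finset.sum_sub_distrib]
  exact Finset.sum_congr rfl fun j _ => by ring

theorem BinaryResponse.memLp [IsFiniteMeasure μ] (r : BinaryResponse d) : MemLp r.θ 2 μ :=
  MemLp.of_bound r.measurable.aestronglyMeasurable r.b
    (Filter.Eventually.of_forall fun a => r.bound a)

/-- Two regression functions that are both close to `f` have close sign vectors. -/
theorem hammingDist_le_of_integral_lt [IsProbabilityMeasure μ]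
    (hbdd : ∀ j, ∀ᵐ a ∂μ, |ef j a| ≤ M) (hef : Orthonormal ℝ ef) (hε' : 0 < ε) {f : Dose d → ℝ}
    (hf : MemLp f 2 μ) {v w : Fin m → Bool}
    (hv : ∫ a, (f a - (signResponse ef hM hb hε h v).θ a) ^ 2 ∂μ < ε ^ 2 * m / 8)
    (hw : ∫ a, (f a - (signResponse ef hM hb hε h w).θ a) ^ 2 ∂μ < ε ^ 2 * m / 8) :
    8 * hammingDist v w ≤ m := by
  set rv := signResponse ef hM hb hε h v
  set rw' := signResponse ef hM hb hε h w
  have hv2 : Integrable (fun a => (f a - rv.θ a) ^ 2) μ := (hf.sub rv.memLp).integrable_sq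
  have hw2 : Integrable (fun a => (f a - rw'.θ a) ^ 2) μ := (hf.sub rw'.memLp).integrable_sq
  have hvw2 : Integrable (fun a => (rv.θ a - rw'.θ a) ^ 2) μ :=
    (rv.memLp.sub rw'.memLp).integrable_sq
  -- By `(x - y)² ≤ 2 x² + 2 y²` the squared distance of the vertices is below `ε² m / 2`, while
  -- Parseval gives `4 ε²` per differing sign.
  have h1 : ∫ a, (rv.θ a - rw'.θ a) ^ 2 ∂μ ≤
      ∫ a, (2 * (f a - rv.θ a) ^ 2 + 2 * (f a - rw'.θ a) ^ 2) ∂μ := by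
    refine integral_mono hvw2 ((hv2.const_mul 2).add (hw2.const_mul 2)) fun a => ?_
    simp only
    nlinarith [sq_nonneg (f a - rv.θ a + (f a - rw'.θ a))]
  rw [integral_add (hv2.const_mul 2) (hw2.const_mul 2), integral_const_mul, integral_const_mul,
    integral_signResponse_sub_sq hM hb hε h hbdd hef] at h1
  have h2 : ε ^ 2 * (8 * hammingDist v w) < ε ^ 2 * (m : ℝ) := by linarith
  have h3 := lt_of_mul_lt_mul_left h2 (by positivity)
  exact_mod_cast h3.le

/-- The σ-algebra on `Ω` is arbitrary so that the result applies to the one generated by the aligned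
observations. -/
theorem measurable_integral_sub_sq [IsProbabilityMeasure μ] {Ω : Type*} (mΩ : MeasurableSpace Ω)
    {f : Ω → Dose d → ℝ} (hf : Measurable[mΩ.prod inferInstance] fun q : Ω × Dose d => f q.1 q.2)
    {g : Dose d → ℝ} (hg : Measurable g) :
    Measurable[mΩ] fun ω => ∫ a, (f ω a - g a) ^ 2 ∂μ := by
  have h1 : Measurable fun q : Ω × Dose d => (f q.1 q.2 - g q.2) ^ 2 :=
    (hf.sub (hg.comp measurable_snd)).pow_const 2
  exact h1.stronglyMeasurable.integral_prod_right.measurable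

end Hypercube

/-! ### Lower bound for estimators that see only the kept observations -/

section LowerBound

variable {X : Type*} [MeasurableSpace X] {d k n : ℕ} {μ : Measure (Dose d)}
  [IsProbabilityMeasure μ] (ν : Measure X) [IsProbabilityMeasure ν] (ρ : Measure (Fin k))
  [IsProbabilityMeasure ρ]

theorem measurable_keepAligned (T : Finset (Fin k)) :
    Measurable (keepAligned (X := X) (d := d) (n := n) T) :=
  measurable_pi_lambda _ fun i => (measurable_keepObs T).comp (measurable_pi_apply i)

theorem pi_map_keepAligned (P : Measure (Obs X d k)) [IsProbabilityMeasure P]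
    (T : Finset (Fin k)) :
    (Measure.pi fun _ : Fin n => P).map (keepAligned T) =
      Measure.pi fun _ : Fin n => P.map (keepObs T) := by
  have : IsProbabilityMeasure (P.map (keepObs T)) :=
    Measure.isProbabilityMeasure_map (measurable_keepObs T).aemeasurable
  exact (Measure.pi_map_pi (μ := fun _ : Fin n => P) (f := fun _ => keepObs T)
    fun _ => (measurable_keepObs T).aemeasurable)

theorem one_add_ofReal_pow_le {x C : ℝ} (hx : 0 ≤ x) (n : ℕ) (hC : n * x ≤ C) :
    (1 + ENNReal.ofReal x) ^ n ≤ ENNReal.ofReal (Real.exp C) := by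
  rw [← ENNReal.ofReal_one, ← ENNReal.ofReal_add zero_le_one hx,
    ← ENNReal.ofReal_pow (by positivity)]
  refine ENNReal.ofReal_le_ofReal ?_
  calc (1 + x) ^ n ≤ Real.exp x ^ n := by
        gcongr
        linarith [Real.add_one_le_exp x]
    _ = Real.exp (n * x) := (Real.exp_nat_mul x n).symm
    _ ≤ _ := Real.exp_le_exp.mpr hC

/-- An estimator that uses only the observations with source in `T` is far from one of the
`2 ^ m` regression functions `∑ j < m, ± ε * ef j` with high probability. -/
theorem exists_signResponse_pi_le {ef : ℕ → Lp ℝ 2 μ} (hef : Orthonormal ℝ ef) {M b ε : ℝ}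
    (hbdd : ∀ j, ∀ᵐ a ∂μ, |ef j a| ≤ M) (hM : 0 ≤ M) (hb : 0 < b) (hε : 0 < ε) {m : ℕ}
    (h : ε * m * M ≤ b) (T : Finset (Fin k)) {θ : (Fin n → Obs X d k) → Dose d → ℝ}
    (hθ : ∀ D, MemLp (θ D) 2 μ)
    (hθm : Measurable[(alignedSigma X d n T).prod inferInstance]
      fun q : (Fin n → Obs X d k) × Dose d => θ q.1 q.2)
    (hchi : n * (ρ.real T * (ε ^ 2 * m / b ^ 2)) ≤ m / 10) {δ : ℝ} (hδ : 0 < δ)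
    (hm : (3 / 4 : ℝ) ^ m * Real.exp (m / 10) ≤ δ ^ 2) :
    ∃ v : Fin m → Bool,
      (Measure.pi fun _ : Fin n => obsLaw ((signResponse ef hM hb hε.le h v).target ν μ) ρ)
        {D | ∫ a, (θ D a - (signResponse ef hM hb hε.le h v).θ a) ^ 2 ∂μ < ε ^ 2 * m / 8} ≤
      ENNReal.ofReal (2 * δ) := by
  set r : (Fin m → Bool) → BinaryResponse d := signResponse ef hM hb hε.le h with hr
  set E : (Fin m → Bool) → Set (Fin n → Obs X d k) := fun v =>
    {D | ∫ a, (θ D a - (r v).θ a) ^ 2 ∂μ < ε ^ 2 * m / 8} with hE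
  have hEm : ∀ v, MeasurableSet[alignedSigma X d n T] (E v) := fun v =>
    (measurable_integral_sub_sq _ hθm (r v).measurable) measurableSet_Iio
  -- Each closeness event is the preimage of an event `F v` about the kept data, so the change of
  -- measure needs only the law of the kept data.
  choose F hF hFE using hEm
  have hEm' : ∀ v, MeasurableSet (E v) := fun v => by
    rw [← hFE v]
    exact measurable_keepAligned T (hF v)
  set r₀ : BinaryResponse d := (r fun _ => true).null with hr₀
  -- The null response depends only on the scale `b`, so one dominating measure serves all sign
  -- vectors.
  have hnull : ∀ v, (r v).null = r₀ := fun v => rfl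
  set κ : Measure (Unit3 X d ⊕ Unit) := (obsLaw (r₀.target ν μ) ρ).map (keepObs T) with hκ
  have hκp : IsProbabilityMeasure κ :=
    Measure.isProbabilityMeasure_map (measurable_keepObs T).aemeasurable
  have hdens : ∀ v, (obsLaw ((r v).target ν μ) ρ).map (keepObs T) =
      κ.withDensity (keptTilt (r v)) := fun v => map_keepObs_eq_withDensity ρ ν (r v) T
  have hdensp : ∀ v, IsProbabilityMeasure (κ.withDensity (keptTilt (r v))) := fun v => by
    rw [← hdens v]
    exact Measure.isProbabilityMeasure_map (measurable_keepObs T).aemeasurable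
  have hpi : ∀ r' : BinaryResponse d, ∀ v,
      (Measure.pi fun _ : Fin n => (obsLaw (r'.target ν μ) ρ).map (keepObs T)) (F v) =
        (Measure.pi fun _ : Fin n => obsLaw (r'.target ν μ) ρ) (E v) := by
    intro r' v
    rw [← pi_map_keepAligned, Measure.map_apply (measurable_keepAligned T) (hF v), hFE]
  have hsum : ∑ v, (Measure.pi fun _ : Fin n => κ) (F v) ≤
      ENNReal.ofReal ((3 / 4) ^ m * Fintype.card (Fin m → Bool)) := by
    simp_rw [hκ, hpi]
    refine sum_measure_le_of_card_le _ E hEm' _ fun D => ?_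
    by_cases hD : ∃ w, D ∈ E w
    · obtain ⟨w, hw⟩ := hD
      refine le_trans ?_ (card_hamming_ball_le w)
      have hsub : ∀ v, D ∈ E v → 8 * hammingDist v w ≤ m := fun v hv =>
        hammingDist_le_of_integral_lt hM hb hε.le h hbdd hef hε (hθ D) hv hw
      exact_mod_cast Nat.card_le_card_of_injective (Subtype.map id hsub)
        (Subtype.map_injective hsub Function.injective_id)
    · push Not at hD
      have : IsEmpty {v // D ∈ E v} := ⟨fun v => hD v v.2⟩
      rw [Nat.card_of_isEmpty, Nat.cast_zero]
      positivity
  have hsq : ∀ v, (∫⁻ z, keptTilt (r v) z ^ 2 ∂κ) ^ n ≤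
      ENNReal.ofReal (Real.exp (m / 10)) := by
    intro v
    have h1 := lintegral_keptTilt_sq ρ (μ := μ) ν (r v) T
    rw [hnull v] at h1
    rw [h1, hr, integral_signResponse_sq hM hb hε.le h hbdd hef]
    exact one_add_ofReal_pow_le (by positivity) n hchi
  -- The parameter `l = 2 δ exp (-m / 10)` makes the second-moment term exactly `δ`; the other is
  -- `(3/4)^m exp (m / 10) / (4 δ) ≤ δ`.
  obtain ⟨v, hv⟩ := exists_pi_withDensity_apply_le κ (fun v => keptTilt (r v))
    (fun v => measurable_keptTilt (r v)) hdensp F hF (2 * δ * Real.exp (-(m / 10)))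
    (by positivity) (Real.exp (m / 10)) ((3 / 4) ^ m) (by positivity) (by positivity) hsq hsum
  refine ⟨v, ?_⟩
  rw [← hdens, hpi] at hv
  refine hv.trans (ENNReal.ofReal_le_ofReal ?_)
  have h2 : Real.exp (-(m / 10 : ℝ)) * Real.exp (m / 10) = 1 := by
    rw [← Real.exp_add]
    simp
  have h3 : 1 / (2 * (2 * δ * Real.exp (-(m / 10 : ℝ)))) * (3 / 4) ^ m =
      (3 / 4) ^ m * Real.exp (m / 10) / (4 * δ) := by
    rw [Real.exp_neg]
    field_simp
    ring
  have h4 : (3 / 4) ^ m * Real.exp (m / 10) / (4 * δ) ≤ δ := by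
    rw [div_le_iff₀ (by positivity)]
    nlinarith
  rw [h3]
  calc 2 * δ * Real.exp (-(m / 10 : ℝ)) / 2 * Real.exp (m / 10) + _
      = δ * (Real.exp (-(m / 10 : ℝ)) * Real.exp (m / 10)) +
        (3 / 4) ^ m * Real.exp (m / 10) / (4 * δ) := by ring
    _ ≤ δ * 1 + δ := by rw [h2]; linarith
    _ = 2 * δ := by ring

end LowerBound

/-! ### Numerical consequences of the sample size threshold -/

section Rates

/-- With `a = 3 log (2 / δ)` and `B = (32 / δ) ^ (1 + t)`, the bound `a ≤ B` gives `√(a + 4 B) - √a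
≥ 2 √B - √B`. So the threshold is at least `B / 4`, and `2 ^ (1 + t) ≥ 4` because `t ≥ 1`. -/
theorem rpow_le_sampleThreshold {α p δ : ℝ} (ht : 1 ≤ (1 - 2 * α) / p) (hδ0 : 0 < δ) (hδ1 : δ < 1) :
    (16 / δ) ^ (1 + (1 - 2 * α) / p) ≤ sampleThreshold α p δ := by
  set t := (1 - 2 * α) / p
  set B : ℝ := (32 / δ) ^ (1 + t) with hB
  have hx : 32 ≤ 32 / δ := by
    rw [le_div_iff₀ hδ0]
    linarith
  have hB0 : 0 ≤ B := by positivity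
  have hBeq : (δ / 32) ^ (-1 - t) = B := by
    rw [hB, show (32 : ℝ) / δ = (δ / 32)⁻¹ by rw [inv_div], Real.inv_rpow (by positivity),
      ← Real.rpow_neg (by positivity)]
    congr 1
    ring
  set a := 3 * Real.log (2 / δ) with ha
  have ha0 : 0 ≤ a := by
    have : 0 ≤ Real.log (2 / δ) := Real.log_nonneg (by rw [le_div_iff₀ hδ0]; linarith)
    positivity
  have haB : a ≤ B := by
    have h1 : Real.log (2 / δ) ≤ 2 / δ - 1 := Real.log_le_sub_one_of_pos (by positivity)
    have h2 : (32 / δ) ^ (2 : ℝ) ≤ B :=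
      Real.rpow_le_rpow_of_exponent_le (by linarith) (by linarith)
    have h3 : 32 * (32 / δ) ≤ (32 / δ) ^ (2 : ℝ) := by
      rw [Real.rpow_two, sq]
      gcongr
    have h4 : 2 / δ = 32 / δ / 16 := by ring
    linarith
  have h1 : √B ≤ √(a + 4 * B) - √a := by
    have h2 : √(4 * B) ≤ √(a + 4 * B) := Real.sqrt_le_sqrt (by linarith)
    have h3 : √(4 * B) = 2 * √B := by
      rw [show (4 : ℝ) * B = 2 ^ 2 * B by norm_num, Real.sqrt_mul (by norm_num),
        Real.sqrt_sq (by norm_num)]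
    have h4 : √a ≤ √B := Real.sqrt_le_sqrt haB
    linarith
  have h2 : B / 4 ≤ sampleThreshold α p δ := by
    rw [sampleThreshold, hBeq]
    have h3 : √B ^ 2 ≤ (√(a + 4 * B) - √a) ^ 2 := by gcongr
    rw [Real.sq_sqrt hB0] at h3
    linarith
  refine le_trans ?_ h2
  have h3 : (4 : ℝ) ≤ 2 ^ (1 + t) := by
    calc (4 : ℝ) = 2 ^ (2 : ℝ) := by norm_num
      _ ≤ _ := Real.rpow_le_rpow_of_exponent_le (by norm_num) (by linarith)
  have h4 : B = 2 ^ (1 + t) * (16 / δ) ^ (1 + t) := by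
    rw [hB, ← Real.mul_rpow (by norm_num) (by positivity)]
    congr 1
    ring
  have h5 : 0 ≤ (16 / δ) ^ (1 + t) := by positivity
  rw [h4]
  nlinarith

/-- Since `3/4 ≤ exp (-1/4)`, the left side is at most `exp (-3 m / 20)`, and `3 m / 20 ≥ 2.4 / δ`
exceeds `-2 log δ`. -/
theorem pow_mul_exp_le_sq {δ : ℝ} (hδ : 0 < δ) {m : ℕ} (hm : 16 / δ ≤ m) :
    (3 / 4 : ℝ) ^ m * Real.exp (m / 10) ≤ δ ^ 2 := by
  have h1 : (3 / 4 : ℝ) ^ m ≤ Real.exp (-(m / 4)) := by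
    calc (3 / 4 : ℝ) ^ m ≤ Real.exp (-1 / 4) ^ m := by
          gcongr
          linarith [Real.add_one_le_exp (-1 / 4 : ℝ)]
      _ = _ := by
          rw [← Real.exp_nat_mul]
          congr 1
          ring
  have h2 : -Real.log δ ≤ 1 / δ := by
    have := Real.log_le_sub_one_of_pos (show 0 < 1 / δ by positivity)
    rw [Real.log_div one_ne_zero hδ.ne', Real.log_one] at this
    linarith
  have h3 : 16 / δ = 16 * (1 / δ) := by ring
  have h4 : 0 < 1 / δ := by positivity
  calc (3 / 4 : ℝ) ^ m * Real.exp (m / 10) ≤ Real.exp (-(m / 4)) * Real.exp (m / 10) := by gcongr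
    _ = Real.exp (-(m / 4) + m / 10) := (Real.exp_add _ _).symm
    _ ≤ Real.exp (Real.log δ + Real.log δ) := Real.exp_le_exp.mpr (by linarith)
    _ = δ ^ 2 := by rw [Real.exp_add, Real.exp_log hδ, sq]

end Rates

end DataFusion

/-! ### Choice of dimension and amplitude, and the lower bound -/

open DataFusion

theorem lemma2
    {X : Type*} [MeasurableSpace X] [StandardBorelSpace X] [Nonempty X] {d : ℕ}
    (μ : Measure (DataFusion.Dose d)) [IsProbabilityMeasure μ]
    {H : Type*} [NormedAddCommGroup H] [InnerProductSpace ℝ H] [CompleteSpace H]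
    [RKHS ℝ H (DataFusion.Dose d) ℝ]
    (hK : DataFusion.KernelCondition (d := d) H)
    (ev : ℕ → ℝ) (ef : ℕ → Lp ℝ 2 μ)
    (hspec : DataFusion.IsSpectralDecomposition H μ ev ef)
    (Me : ℝ) (hbdd : ∀ j, ∀ᵐ a ∂μ, |ef j a| ≤ Me)
    (p G₁ G₂ : ℝ) (hp0 : 0 < p) (hp1 : p < 1) (hG₁ : 0 < G₁) (hG₂ : 0 < G₂)
    (hdecay : ∀ j : ℕ, G₁ * ((j : ℝ) + 1) ^ (-(1 / p)) ≤ ev j ∧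
      ev j ≤ G₂ * ((j : ℝ) + 1) ^ (-(1 / p)))
    (α R sd L cμ : ℝ) (hα0 : 0 < α) (hα1 : α < 1 / 2) (hαp : p ≤ 1 - 2 * α)
    (hR : 0 < R) (hsd : 0 < sd) (hL : 0 < L) (hcμ : 1 ≤ cμ) :
    ∃ c : ℝ, 0 < c ∧
      ∀ (k : ℕ) (SX SY : Finset (Fin k)) (Mξ Mη c₁ : ℝ), 1 ≤ Mξ → 1 ≤ Mη → 1 ≤ c₁ →
      ∀ δ : ℝ, 0 < δ → δ < 1 →
      ∀ (n : ℕ) (nXY : ℝ), DataFusion.sampleThreshold α p δ ≤ nXY → nXY ≤ n →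
      ∀ θ : (Fin n → DataFusion.Obs X d k) → DataFusion.Dose d → ℝ,
        DataFusion.IsNoFusionEstimator μ SX SY θ →
      ∀ q : Fin k → ℝ, (∀ s, 0 ≤ q s) → ∑ s, q s = 1 →
        ∑ s ∈ SX ∩ SY, q s = nXY / n → Mξ⁻¹ ≤ ∑ s ∈ SX, q s → Mη⁻¹ ≤ ∑ s ∈ SY, q s →
      ∃ P ∈ DataFusion.fusionModel SX SY Mξ Mη c₁
          (DataFusion.targetModel X H ev ef α R sd L cμ),
        (∀ s, (P : Measure (DataFusion.Obs X d k)).real (DataFusion.sourceIn X d {s}) = q s) ∧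
        (P : Measure (DataFusion.Obs X d k)).real (DataFusion.sourceIn X d (SX ∩ SY)) = nXY / n ∧
        1 - 2 * δ ≤
          (Measure.pi fun _ : Fin n => (P : Measure (DataFusion.Obs X d k))).real
            {D | c * δ * (1 + √(3 * Real.log (1 / δ) / nXY)) ^
                    (-((1 - 2 * α) / (p + (1 - 2 * α)))) *
                  nXY ^ (-((1 - 2 * α) / (p + (1 - 2 * α)))) ≤
                DataFusion.risk μ SX SY (P : Measure (DataFusion.Obs X d k)) (θ D)
                  (DataFusion.trueNuisance μ SX SY (P : Measure (DataFusion.Obs X d k)))} := by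
  set t := (1 - 2 * α) / p with ht
  have ht1 : 1 ≤ t := by rwa [ht, le_div_iff₀ hp0, one_mul]
  have hev : ∀ j, 0 < ev j := fun j => lt_of_lt_of_le (by positivity) (hdecay j).1
  set M := max Me 1 with hMdef
  have hM : 0 < M := lt_of_lt_of_le one_pos (le_max_right _ _)
  have hbdd' : ∀ j, ∀ᵐ a ∂μ, |ef j a| ≤ M := fun j => by
    filter_upwards [hbdd j] with a ha using ha.trans (le_max_left _ _)
  -- The outcome scale obeys the moment condition through `2 b ≤ sd, L`, and the mean bound through
  -- `b ≤ 1`.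
  set b := min (min sd L / 2) 1 with hbdef
  have hb : 0 < b := lt_min (by have := lt_min hsd hL; positivity) one_pos
  have hb1 : b ≤ 1 := min_le_right _ _
  have hbsd : 2 * b ≤ sd := by
    have h1 : b ≤ min sd L / 2 := min_le_left _ _
    have h2 : min sd L ≤ sd := min_le_left _ _
    linarith
  have hbL : 2 * b ≤ L := by
    have h1 : b ≤ min sd L / 2 := min_le_left _ _
    have h2 : min sd L ≤ L := min_le_right _ _
    linarith
  -- The three bounds on `c0` serve the source condition, the sup bound `|θ| ≤ b` and the chi-square
  -- budget, in this order.
  obtain ⟨c0, hc0, hc0R, hc0M, hc0b⟩ : ∃ c0 : ℝ, 0 < c0 ∧ c0 ≤ R ^ 2 * G₁ ^ (1 - 2 * α) ∧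
      c0 * M ^ 2 ≤ b ^ 2 ∧ c0 ≤ b ^ 2 / 10 := by
    refine ⟨min (R ^ 2 * G₁ ^ (1 - 2 * α)) (min (b ^ 2 / M ^ 2) (b ^ 2 / 10)),
      lt_min (by positivity) (lt_min (by positivity) (by positivity)), min_le_left _ _, ?_,
      (min_le_right _ _).trans (min_le_right _ _)⟩
    rw [← le_div_iff₀ (by positivity)]
    exact (min_le_right _ _).trans (min_le_left _ _)
  -- The factor `1 / 8` is the separation radius and `2 ^ (-t)` pays for rounding up, `m ≤ 2 u`.
  refine ⟨c0 * 2 ^ (-t) / 8, by positivity, ?_⟩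
  intro k SX SY Mξ Mη c₁ hMξ hMη hc₁ δ hδ0 hδ1 n N hN hNn θ hθ q hq hq1 hqXY hqX hqY
  have hN16 : (16 / δ) ^ (1 + t) ≤ N := (rpow_le_sampleThreshold ht1 hδ0 hδ1).trans hN
  have hN0 : 0 < N := lt_of_lt_of_le (by positivity) hN16
  have hn0 : (0 : ℝ) < n := hN0.trans_le hNn
  set u := N ^ (1 / (1 + t)) with hu
  have hu16 : 16 / δ ≤ u := by
    calc 16 / δ = ((16 / δ) ^ (1 + t)) ^ (1 / (1 + t)) := by
          rw [← Real.rpow_mul (by positivity), mul_one_div_cancel (by positivity), Real.rpow_one]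
      _ ≤ u := Real.rpow_le_rpow (by positivity) hN16 (by positivity)
  have hu1 : 1 ≤ u := by
    refine le_trans ?_ hu16
    rw [le_div_iff₀ hδ0]
    linarith
  set m := ⌈u⌉₊ with hm
  have hum : u ≤ m := Nat.le_ceil u
  have hmu : (m : ℝ) ≤ 2 * u := by
    have := (Nat.ceil_lt_add_one (by positivity : 0 ≤ u)).le
    linarith
  have hm1 : (1 : ℝ) ≤ m := hu1.trans hum
  have hm0 : (0 : ℝ) < m := by linarith
  have hNm : N ≤ (m : ℝ) ^ (1 + t) := by
    calc N = u ^ (1 + t) := by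
          rw [hu, ← Real.rpow_mul hN0.le, one_div_mul_cancel (by positivity), Real.rpow_one]
      _ ≤ _ := by gcongr
  -- With this amplitude `ε² m = c0 * m ^ (-t)`, which offsets the growth `ev j ^ (2α - 1) ≲ m ^ t`
  -- in the source norm.
  set ε := √(c0 * (m : ℝ) ^ (-(1 + t))) with hεdef
  have hε2 : ε ^ 2 = c0 * (m : ℝ) ^ (-(1 + t)) := Real.sq_sqrt (by positivity)
  have hε : 0 < ε := Real.sqrt_pos.mpr (by positivity)
  have hε2m : ε ^ 2 * m = c0 * (m : ℝ) ^ (-t) := by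
    rw [hε2, mul_assoc, ← Real.rpow_add_one hm0.ne']
    congr 2
    ring
  have hεb : ε * m * M ≤ b := by
    refine le_of_sq_le_sq ?_ hb.le
    -- Here `t ≥ 1`, that is `p ≤ 1 - 2α`, keeps the sum of `m` bounded terms below `b`.
    have h1 : (m : ℝ) ^ (-t) * m ≤ 1 := by
      rw [← Real.rpow_add_one hm0.ne']
      exact Real.rpow_le_one_of_one_le_of_nonpos hm1 (by linarith)
    calc (ε * m * M) ^ 2 = ε ^ 2 * m * m * M ^ 2 := by ring
      _ = c0 * M ^ 2 * ((m : ℝ) ^ (-t) * m) := by rw [hε2m]; ring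
      _ ≤ c0 * M ^ 2 * 1 := by gcongr
      _ ≤ b ^ 2 := by linarith
  have : IsProbabilityMeasure (sourceLaw q) := isProbabilityMeasure_sourceLaw hq hq1
  have hρ : ∀ T : Finset (Fin k), (sourceLaw q).real T = ∑ s ∈ T, q s := fun T => by
    rw [measureReal_def, sourceLaw_coe hq,
      ENNReal.toReal_ofReal (Finset.sum_nonneg fun s _ => hq s)]
  have hρ0 : ∀ T : Finset (Fin k), ∀ K : ℝ, 1 ≤ K → K⁻¹ ≤ ∑ s ∈ T, q s →
      sourceLaw q T ≠ 0 := by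
    intro T K hK1 hT h0
    rw [← hρ, measureReal_def, h0, ENNReal.toReal_zero] at hT
    exact absurd hT (not_le.mpr (by positivity))
  have hchi : n * ((sourceLaw q).real ↑(SX ∩ SY) * (ε ^ 2 * m / b ^ 2)) ≤ m / 10 := by
    rw [hρ, hqXY, hε2m]
    have h1 : N * (m : ℝ) ^ (-t) ≤ m := by
      calc N * (m : ℝ) ^ (-t) ≤ (m : ℝ) ^ (1 + t) * (m : ℝ) ^ (-t) := by gcongr
        _ = m := by
          rw [← Real.rpow_add hm0, show 1 + t + -t = 1 by ring, Real.rpow_one]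
    have h2 : c0 / b ^ 2 ≤ 1 / 10 := by
      rw [div_le_iff₀ (by positivity)]
      linarith
    calc (n : ℝ) * (N / n * (c0 * (m : ℝ) ^ (-t) / b ^ 2)) = c0 / b ^ 2 * (N * (m : ℝ) ^ (-t)) := by
          field_simp
      _ ≤ 1 / 10 * (m : ℝ) := by gcongr
      _ = (m : ℝ) / 10 := by ring
  obtain ⟨x₀⟩ := ‹Nonempty X›
  -- The regression ignores the covariate, so a point mass suffices.
  set ν := Measure.dirac x₀
  obtain ⟨v, hv⟩ := exists_signResponse_pi_le ν (sourceLaw q) hspec.orthonormal hbdd' hM.le hb hε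
    hεb (SX ∩ SY) hθ.memLp hθ.measurable hchi hδ0
    (pow_mul_exp_le_sq hδ0 (hu16.trans hum))
  set r : BinaryResponse d := signResponse ef hM.le hb hε.le hεb v with hr
  have hfus := fusionConditions_obsLaw (r.target ν μ) (sourceLaw q) (SX := SX) (SY := SY)
    (Mξ := Mξ) (c₁ := c₁) hMη hc₁
    (by rwa [hρ]) (by rwa [hρ])
  have hreal : ∀ T : Finset (Fin k),
      (obsLaw (r.target ν μ) (sourceLaw q)).real (sourceIn X d T) = ∑ s ∈ T, q s := fun T => by
    rw [← hρ, measureReal_def, obsLaw_sourceIn, measureReal_def]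
  have hsource : SourceCondition H ev ef α R (cdrf (r.target ν μ)) := by
    refine hspec.sourceCondition_sum hK hev hR.le
      ((r.cdrf_target ν μ).trans (signResponse_ae_eq hM.le hb hε.le hεb hbdd' v)) ?_
    have h1 : ∀ j ∈ Finset.range m, signCoeff ε v j ^ 2 * ev j ^ (2 * α - 1) ≤
        ε ^ 2 * (G₁ ^ (2 * α - 1) * (m : ℝ) ^ t) := by
      intro j hj
      rw [signCoeff_sq ε v (Finset.mem_range.mp hj)]
      have hjm : (j : ℝ) + 1 ≤ m := by exact_mod_cast Finset.mem_range.mp hj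
      have h2 : G₁ * (m : ℝ) ^ (-(1 / p)) ≤ ev j := by
        refine le_trans ?_ (hdecay j).1
        gcongr ?_ * ?_
        exact Real.rpow_le_rpow_of_nonpos (by positivity) hjm (by simp [hp0.le])
      have h3 : ev j ^ (2 * α - 1) ≤ (G₁ * (m : ℝ) ^ (-(1 / p))) ^ (2 * α - 1) :=
        Real.rpow_le_rpow_of_nonpos (by positivity) h2 (by linarith)
      rw [Real.mul_rpow hG₁.le (by positivity), ← Real.rpow_mul hm0.le,
        show -(1 / p) * (2 * α - 1) = t by rw [ht]; ring] at h3
      gcongr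
    refine (Finset.sum_le_sum h1).trans ?_
    rw [Finset.sum_const, Finset.card_range, nsmul_eq_mul]
    have h4 : (m : ℝ) ^ (-t) * (m : ℝ) ^ t = 1 := by
      rw [← Real.rpow_add hm0]
      simp
    have h5 : G₁ ^ (1 - 2 * α) * G₁ ^ (2 * α - 1) = 1 := by
      rw [← Real.rpow_add hG₁]
      simp
    calc (m : ℝ) * (ε ^ 2 * (G₁ ^ (2 * α - 1) * (m : ℝ) ^ t))
        = (ε ^ 2 * m) * (G₁ ^ (2 * α - 1) * (m : ℝ) ^ t) := by ring
      _ = c0 * G₁ ^ (2 * α - 1) * ((m : ℝ) ^ (-t) * (m : ℝ) ^ t) := by rw [hε2m]; ring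
      _ ≤ (R ^ 2 * G₁ ^ (1 - 2 * α)) * G₁ ^ (2 * α - 1) * 1 := by rw [h4]; gcongr
      _ = R ^ 2 * (G₁ ^ (1 - 2 * α) * G₁ ^ (2 * α - 1)) := by ring
      _ = R ^ 2 := by rw [h5, mul_one]
  have hmom : MomentConditions μ sd L cμ (r.target ν μ) :=
    r.momentConditions_target ν μ hbsd hbL hcμ fun a => (r.bound a).trans hb1
  refine ⟨⟨obsLaw (r.target ν μ) (sourceLaw q), inferInstance⟩,
    ⟨⟨r.target ν μ, inferInstance⟩, ⟨hmom, hsource⟩, hfus⟩, ?_, ?_, ?_⟩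
  · intro s
    exact (hreal {s}).trans (by simp)
  · exact (hreal _).trans hqXY
  · simp only [ProbabilityMeasure.coe_mk]
    set P := Measure.pi fun _ : Fin n => obsLaw (r.target ν μ) (sourceLaw q) with hP
    set E : Set (Fin n → Obs X d k) :=
      {D | ∫ a, (θ D a - r.θ a) ^ 2 ∂μ < ε ^ 2 * m / 8} with hE
    have hEc : 1 - 2 * δ ≤ P.real Eᶜ := by
      have h1 : P.real E ≤ 2 * δ :=
        ENNReal.toReal_le_of_le_ofReal (by positivity) hv
      have h2 : P.real Set.univ ≤ P.real E + P.real Eᶜ := by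
        rw [← Set.union_compl_self E]
        exact measureReal_union_le _ _
      rw [probReal_univ] at h2
      linarith
    refine hEc.trans (measureReal_mono fun D hD => ?_)
    have hD' : ε ^ 2 * m / 8 ≤ ∫ a, (θ D a - r.θ a) ^ 2 ∂μ := not_lt.mp hD
    change _ ≤ risk μ SX SY _ (θ D) _
    rw [risk_obsLaw (sourceLaw q) ν r (hρ0 SX Mξ hMξ hqX) (hρ0 SY Mη hMη hqY) (hθ.memLp D)]
    refine le_trans ?_ hD'
    have hrate : -((1 - 2 * α) / (p + (1 - 2 * α))) = 1 / (1 + t) * -t := by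
      rw [ht]
      field_simp
    have hrate0 : -((1 - 2 * α) / (p + (1 - 2 * α))) ≤ 0 := by
      rw [hrate, mul_neg]
      have : 0 ≤ 1 / (1 + t) * t := by positivity
      linarith
    -- This factor and `δ` are both at most one, and the final estimate drops them.
    have h1 : (1 + √(3 * Real.log (1 / δ) / N)) ^ (-((1 - 2 * α) / (p + (1 - 2 * α)))) ≤ 1 :=
      Real.rpow_le_one_of_one_le_of_nonpos
        (by linarith [Real.sqrt_nonneg (3 * Real.log (1 / δ) / N)]) hrate0
    have h2 : N ^ (-((1 - 2 * α) / (p + (1 - 2 * α)))) = u ^ (-t) := by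
      rw [hrate, Real.rpow_mul hN0.le]
    have h3 : 2 ^ (-t) * u ^ (-t) ≤ (m : ℝ) ^ (-t) := by
      rw [← Real.mul_rpow (by norm_num) (by positivity)]
      exact Real.rpow_le_rpow_of_nonpos hm0 hmu (by linarith)
    rw [hε2m, h2]
    calc c0 * 2 ^ (-t) / 8 * δ * (1 + √(3 * Real.log (1 / δ) / N)) ^
            (-((1 - 2 * α) / (p + (1 - 2 * α)))) * u ^ (-t)
        ≤ c0 * 2 ^ (-t) / 8 * 1 * 1 * u ^ (-t) := by gcongr
      _ = c0 * (2 ^ (-t) * u ^ (-t)) / 8 := by ring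
      _ ≤ c0 * (m : ℝ) ^ (-t) / 8 := by gcongr
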